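/- Call $G$ a graph if it is finite, simple, undirected and nonempty; write $|G|$ for its number of vertices and $N(v)$ for the open neighbourhood of a vertex $v$. A set $S\subseteq V(G)$ is a solution of Reflexive-AllOff if $|N(v)\cap S|$ is even for every $v\in S$ and odd for every $v\in V(G)\setminus S$; it is a solution of AllOff if $|N(v)\cap S|$ is odd for every $v\in V(G)$. An instance of either problem consists of a graph $G$, a path decomposition of $G$ (with at most $|G|$ bags; its width is denoted by $\mathrm{pw}$), and an integer $0\le s\le |G|$. The Strong Exponential-Time Hypothesis (SETH) states that for every $\varepsilon\in(0,1)$ there is a $k\ge 3$ such that $k$-SAT on formulas with $n$ variables and $m$ clauses cannot be decided in time $(2-\varepsilon)^n\cdot(n+m)^{O(1)}$. Algorithms are deterministic programs of a random access machine with logarithmic cost, graphs are given by adjacency matrices and bags by characteristic vectors. Assume SETH. Then, for every $\varepsilon>0$, there is no algorithm that decides in time $(2-\varepsilon)^{\mathrm{pw}}\cdot|G|^{O(1)}$, for every given instance $(G,\text{path decomposition},s)$, whether $G$ has a solution of Reflexive-AllOff of size at most $s$; and there is no such algorithm for AllOff. The same holds for both problems if a solution of size exactly $s$ is asked for. -/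

import Mathlib

/-! ### Random access machines with logarithmic cost -/

namespace RAM

/-- A machine configuration: the registers and the random access memory,
all holding natural numbers. -/
structure State where
  reg : ℕ → ℕ
  mem : ℕ → ℕ

/-- Expressions: literals, registers, indirect memory access, and the arithmetic operations
(`sub` is truncated subtraction, `div` is division with rounding down). -/
inductive Expr where
  | lit (c : ℕ)
  | reg (i : ℕ)
  | load (addr : Expr)
  | add (a b : Expr)
  | sub (a b : Expr)
  | mul (a b : Expr)
  | div (a b : Expr)

/-- The value of an expression in a given configuration. -/
def Expr.eval (s : State) : Expr → ℕ
  | .lit c => c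
  | .reg i => s.reg i
  | .load a => s.mem (a.eval s)
  | .add a b => a.eval s + b.eval s
  | .sub a b => a.eval s - b.eval s
  | .mul a b => a.eval s * b.eval s
  | .div a b => a.eval s / b.eval s

/-- Logarithmic cost of evaluating an expression: every operation is charged one unit plus the
bit length of the value that it produces. (The bit lengths of the operands and of the addresses
are charged at the operations that produce them.) -/
def Expr.cost (s : State) : Expr → ℕ
  | .lit c => 1 + Nat.size c
  | .reg i => 1 + Nat.size (s.reg i)
  | .load a => a.cost s + (1 + Nat.size (s.mem (a.eval s)))
  | .add a b => a.cost s + b.cost s + (1 + Nat.size (a.eval s + b.eval s))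
  | .sub a b => a.cost s + b.cost s + (1 + Nat.size (a.eval s - b.eval s))
  | .mul a b => a.cost s + b.cost s + (1 + Nat.size (a.eval s * b.eval s))
  | .div a b => a.cost s + b.cost s + (1 + Nat.size (a.eval s / b.eval s))

/-- Programs in structured form. A test `e` counts as true if the value of `e` is not zero. -/
inductive Prog where
  | skip
  | set (i : ℕ) (e : Expr)
  | store (addr e : Expr)
  | seq (p q : Prog)
  | ite (e : Expr) (p q : Prog)
  | while (e : Expr) (p : Prog)

/-- Register `i` receives the value `v`. -/
def State.setReg (s : State) (i v : ℕ) : State :=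
  { s with reg := Function.update s.reg i v }

/-- Memory cell `a` receives the value `v`. -/
def State.setMem (s : State) (a v : ℕ) : State :=
  { s with mem := Function.update s.mem a v }

/-- `Exec p s t s'`: started in configuration `s`, the program `p` halts in configuration `s'`,
at total cost `t`. -/
inductive Exec : Prog → State → ℕ → State → Prop
  | skip (s : State) : Exec .skip s 1 s
  | set (i : ℕ) (e : Expr) (s : State) :
      Exec (.set i e) s (1 + e.cost s) (s.setReg i (e.eval s))
  | store (a e : Expr) (s : State) :
      Exec (.store a e) s (1 + a.cost s + e.cost s) (s.setMem (a.eval s) (e.eval s))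
  | seq {p q : Prog} {s s₁ s₂ : State} {t₁ t₂ : ℕ} :
      Exec p s t₁ s₁ → Exec q s₁ t₂ s₂ → Exec (.seq p q) s (t₁ + t₂) s₂
  | ite_true {e : Expr} {p q : Prog} {s s₁ : State} {t : ℕ} :
      e.eval s ≠ 0 → Exec p s t s₁ → Exec (.ite e p q) s (1 + e.cost s + t) s₁
  | ite_false {e : Expr} {p q : Prog} {s s₁ : State} {t : ℕ} :
      e.eval s = 0 → Exec q s t s₁ → Exec (.ite e p q) s (1 + e.cost s + t) s₁
  | while_true {e : Expr} {p : Prog} {s s₁ s₂ : State} {t₁ t₂ : ℕ} :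
      e.eval s ≠ 0 → Exec p s t₁ s₁ → Exec (.while e p) s₁ t₂ s₂ →
        Exec (.while e p) s (1 + e.cost s + t₁ + t₂) s₂
  | while_false {e : Expr} {p : Prog} {s : State} :
      e.eval s = 0 → Exec (.while e p) s (1 + e.cost s) s

/-- The initial configuration: the input occupies the memory cells `0, 1, 2, …`;
all other cells and all registers are zero. -/
def State.init (input : List ℕ) : State where
  reg := fun _ => 0
  mem := fun i => input.getD i 0

/-- The problem `L`, whose instances `x : α` are presented as `encode x`, is decided by some
program that halts on every instance `x` at cost at most `T x`. The answer is read off register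
`0`: nonzero means yes. -/
def DecidableInTime {α : Type*} (encode : α → List ℕ) (L : α → Prop) (T : α → ℝ) : Prop :=
  ∃ p : Prog, ∀ x : α, ∃ (t : ℕ) (s : State),
    Exec p (State.init (encode x)) t s ∧ (t : ℝ) ≤ T x ∧ (s.reg 0 ≠ 0 ↔ L x)

end RAM

/-! ### `k`-SAT and the Strong Exponential-Time Hypothesis -/

/-- A `k`-CNF formula: a list of clauses over the variables `0, …, numVars - 1`. A clause consists
of `k` literals, which need not be distinct, so that a clause of this kind is a nonempty
clause with at most `k` different literals. The literal `(i, true)` is the variable `i`, the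
literal `(i, false)` is its negation. -/
structure KCNF (k : ℕ) where
  numVars : ℕ
  clauses : List (Fin k → Fin numVars × Bool)

namespace KCNF

/-- Some assignment makes at least one literal of each clause true. -/
def Satisfiable {k : ℕ} (φ : KCNF k) : Prop :=
  ∃ π : Fin φ.numVars → Bool, ∀ C ∈ φ.clauses, ∃ l : Fin k, π (C l).1 = (C l).2

/-- The formula as a sequence of numbers: the number of variables, the number of clauses, and then
the literals of all clauses, where `2 i + 1` stands for variable `i` and `2 i` for its negation. -/
def encode {k : ℕ} (φ : KCNF k) : List ℕ :=
  [φ.numVars, φ.clauses.length] ++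
    φ.clauses.flatMap fun C => List.ofFn fun l : Fin k => 2 * ((C l).1 : ℕ) + ((C l).2).toNat

end KCNF

/-- The Strong Exponential-Time Hypothesis: for every `ε > 0` there is some `k` such that `k`-SAT
with `n` variables and `m` clauses cannot be decided in time `(2 - ε) ^ n * (n + m) ^ O(1)`. -/
def SETH : Prop :=
  ∀ ε : ℝ, 0 < ε → ε < 1 → ∃ k : ℕ, 3 ≤ k ∧
    ¬ ∃ C c : ℕ, RAM.DecidableInTime (KCNF.encode (k := k)) KCNF.Satisfiable
      fun φ => C * (2 - ε) ^ φ.numVars * ((φ.numVars + φ.clauses.length + 1 : ℕ) : ℝ) ^ c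

/-! ### Path decompositions and (σ, ρ)-sets -/

/-- A path decomposition of `G` whose underlying path has the nodes `0, 1, …, length - 1`. -/
structure PathDecomposition {V : Type*} (G : SimpleGraph V) where
  length : ℕ
  bag : Fin length → Finset V
  vertex_mem : ∀ v : V, ∃ i, v ∈ bag i
  edge_mem : ∀ u v : V, G.Adj u v → ∃ i, u ∈ bag i ∧ v ∈ bag i
  connected : ∀ (v : V) (i j l : Fin length), i ≤ j → j ≤ l → v ∈ bag i → v ∈ bag l → v ∈ bag j

/-- The width: the largest size of a bag, minus one. -/
def PathDecomposition.width {V : Type*} {G : SimpleGraph V} (P : PathDecomposition G) : ℕ :=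
  (Finset.univ.sup fun i => (P.bag i).card) - 1

open Classical in
/-- `S` is a `(σ, ρ)`-set of `G`: every selected vertex has a number of selected neighbours in `σ`,
every unselected vertex has a number of selected neighbours in `ρ`. -/
def IsSigmaRhoSet {V : Type*} (G : SimpleGraph V) (σ ρ : Set ℕ) (S : Finset V) : Prop :=
  (∀ v ∈ S, (S.filter fun w => G.Adj v w).card ∈ σ) ∧
    ∀ v ∉ S, (S.filter fun w => G.Adj v w).card ∈ ρ

/-- A solution of Reflexive-AllOff: `σ` is the set of even, `ρ` the set of odd numbers. -/
def IsReflexiveAllOffSolution {V : Type*} (G : SimpleGraph V) (S : Finset V) : Prop :=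
  IsSigmaRhoSet G {x | Even x} {x | Odd x} S

/-- A solution of AllOff: both `σ` and `ρ` are the set of odd numbers. -/
def IsAllOffSolution {V : Type*} (G : SimpleGraph V) (S : Finset V) : Prop :=
  IsSigmaRhoSet G {x | Odd x} {x | Odd x} S

/-- An instance: a nonempty finite graph, a path decomposition of it with at most as many bags as
there are vertices, and a number `size` that does not exceed the number of vertices. (So the length
of the input is polynomial in the number of vertices. Every path decomposition can be brought into
this form by dropping redundant bags.) -/
structure LightsOutInstance where
  order : ℕ
  order_pos : 0 < order
  graph : SimpleGraph (Fin order)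
  decomp : PathDecomposition graph
  length_le : decomp.length ≤ order
  size : ℕ
  size_le : size ≤ order

namespace LightsOutInstance

open Classical in
/-- The instance as a sequence of numbers: the number of vertices, the number of bags, the number
`size`, the rows of the adjacency matrix, and the characteristic vectors of the bags. -/
noncomputable def encode (I : LightsOutInstance) : List ℕ :=
  [I.order, I.decomp.length, I.size] ++
    ((List.finRange I.order).flatMap fun u =>
      (List.finRange I.order).map fun v => if I.graph.Adj u v then 1 else 0) ++
    ((List.finRange I.decomp.length).flatMap fun i =>
      (List.finRange I.order).map fun v => if v ∈ I.decomp.bag i then 1 else 0)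

/-- There is a solution of size at most the given number. -/
def HasSolutionLE (I : LightsOutInstance)
    (IsSol : Finset (Fin I.order) → Prop) : Prop :=
  ∃ S : Finset (Fin I.order), IsSol S ∧ S.card ≤ I.size

/-- There is a solution of size exactly the given number. -/
def HasSolutionEQ (I : LightsOutInstance)
    (IsSol : Finset (Fin I.order) → Prop) : Prop :=
  ∃ S : Finset (Fin I.order), IsSol S ∧ S.card = I.size

end LightsOutInstance

/-- The problem `L` on graphs `G` given with a path decomposition of width `pw` can be decided in
time `b ^ pw * |G| ^ O(1)`, where `|G|` is the number of vertices. -/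
def DecidableInPathwidthTime (b : ℝ) (L : LightsOutInstance → Prop) : Prop :=
  ∃ C c : ℕ, RAM.DecidableInTime LightsOutInstance.encode L
    fun I => C * b ^ I.decomp.width * (I.order : ℝ) ^ c

/-!
The reduction maps a `k`-CNF formula with `n` variables to a graph with a path decomposition of
width `n + O(1)`, so that an algorithm with running time `(2 - ε) ^ pw * |G| ^ O(1)` would
contradict SETH.

Membership in a solution is a vector over the field with two elements, and being a solution is the
system of equations `r * x v + ∑ x u = 1`, summed over the neighbours `u` of `v`, where `r = 1`
for Reflexive-AllOff and `r = 2` (that is, zero) for AllOff. Both problems are treated at once.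
On a path with `(r + 2) * m + r + 1` vertices the system has exactly two solutions. They are periodic with
period `r + 2`, have the same number of ones, and show in each period the value of the first vertex
as well as its complement. One such path, a wire, serves for each variable; the period number `j`
is used by the clause number `j`.

All constraints are linear, so the disjunction in a clause has to come from the bound on the size.
For each clause and each set `T` of its literals there is a gate, a vertex adjacent to the wire
vertices of the literals in `T`, and for `r = 2` also to a leaf. The value of the gate (for `r = 2`,
of the leaf) is forced to be `1 + ∑ s ∈ T, y s`, where `y s` are the values of the literals. If some
literal is true, exactly half of the `2 ^ k` sums are zero, otherwise all of them are
(`sum_val_affine`): an unsatisfied clause costs `2 ^ (k - 1)` additional vertices, and all satisfied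
clauses cost the same, so that asking for size at most `s` or exactly `s` makes no difference. The
gates do not disturb the wires, since for `k ≥ 3` any two literals are in an even number of common
sets `T`, so that the values of the gates around a wire vertex add up to zero
(`sum_linear_mul_affine`). Hence the solutions correspond to the assignments
(`Layout.isSol_sol`, `Layout.IsSol.eq_sol`), with the sizes given by `Layout.sum_val_sol`. A window
of `n + 1` consecutive wire vertices, together with the `O(2 ^ k)` gates and leaves of one clause,
sweeps over the graph as a path decomposition (`Layout.width_decomp_le`).

The reduction is carried out by a random access machine in polynomial time, because each entry of
the encoded instance is the value of one fixed expression in the formula and the number of the entry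
(`Layout.eval_cellExpr`); a program with three loops writes all entries
(`RAM.exists_exec_rewriteProg`). -/

/-! ### A machine that rewrites its input -/

namespace RAM

/-- All registers and all memory cells hold numbers of size at most `Q`. -/
def State.BoundedBy (s : State) (Q : ℕ) : Prop :=
  (∀ i, s.reg i ≤ Q) ∧ ∀ a, s.mem a ≤ Q

theorem size_le_self (x : ℕ) : Nat.size x ≤ x :=
  Nat.size_le.2 Nat.lt_two_pow_self

/-- The value and the cost of a fixed expression are polynomial in the numbers held by the machine.
The bit length of a number is estimated by the number itself, which is good enough since the
numbers in question are polynomial in the input parameters. -/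
theorem Expr.exists_eval_cost_le (e : Expr) : ∃ d : ℕ, ∀ (s : State) (Q : ℕ), s.BoundedBy Q →
    e.eval s ≤ (Q + 2) ^ d ∧ e.cost s ≤ (Q + 2) ^ d := by
  have binary : ∀ (a b : Expr) (d₁ d₂ : ℕ) (s : State) (Q v : ℕ),
      (a.eval s ≤ (Q + 2) ^ d₁ ∧ a.cost s ≤ (Q + 2) ^ d₁) →
      (b.eval s ≤ (Q + 2) ^ d₂ ∧ b.cost s ≤ (Q + 2) ^ d₂) →
      (v ≤ a.eval s + b.eval s ∨ v ≤ a.eval s * b.eval s) →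
      v ≤ (Q + 2) ^ (d₁ + d₂ + 3) ∧
        a.cost s + b.cost s + (1 + Nat.size v) ≤ (Q + 2) ^ (d₁ + d₂ + 3) := by
    intro a b d₁ d₂ s Q v ⟨ha, ha'⟩ ⟨hb, hb'⟩ hv
    have hsize := size_le_self v
    have h₁ : (Q + 2) ^ d₁ ≤ (Q + 2) ^ (d₁ + d₂) :=
      Nat.pow_le_pow_right (by omega) (by omega)
    have h₂ : (Q + 2) ^ d₂ ≤ (Q + 2) ^ (d₁ + d₂) :=
      Nat.pow_le_pow_right (by omega) (by omega)
    have h₀ : 1 ≤ (Q + 2) ^ (d₁ + d₂) := Nat.one_le_pow _ _ (by omega)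
    have hmul : a.eval s * b.eval s ≤ (Q + 2) ^ (d₁ + d₂) := by
      rw [pow_add]; exact Nat.mul_le_mul ha hb
    have h₈ : 8 * (Q + 2) ^ (d₁ + d₂) ≤ (Q + 2) ^ (d₁ + d₂ + 3) := by
      rw [pow_add _ (d₁ + d₂), mul_comm]
      exact Nat.mul_le_mul_left _ (by
        calc 8 = 2 ^ 3 := by norm_num
          _ ≤ (Q + 2) ^ 3 := Nat.pow_le_pow_left (by omega) 3)
    omega
  induction e with
  | lit c =>
    refine ⟨c + 1, fun s Q _ => ?_⟩
    have h₁ : 2 ^ (c + 1) ≤ (Q + 2) ^ (c + 1) := Nat.pow_le_pow_left (by omega) _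
    have h₂ : c + 1 < 2 ^ (c + 1) := Nat.lt_two_pow_self
    have h₃ := size_le_self c
    simp only [Expr.eval, Expr.cost]
    omega
  | reg i =>
    refine ⟨1, fun s Q h => ?_⟩
    have h₁ := h.1 i
    have h₂ := size_le_self (s.reg i)
    simp only [Expr.eval, Expr.cost, pow_one]
    omega
  | load a ih =>
    obtain ⟨d, hd⟩ := ih
    refine ⟨d + 1 + 3, fun s Q h => ?_⟩
    have h₁ := h.2 (a.eval s)
    have h₂ := size_le_self (s.mem (a.eval s))
    have h₄ := (hd s Q h).2
    have h₅ : (Q + 2) ^ d ≤ (Q + 2) ^ (d + 1) := Nat.pow_le_pow_right (by omega) (by omega)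
    have h₆ : Q + 2 ≤ (Q + 2) ^ (d + 1) := Nat.le_self_pow (by omega) _
    have h₇ : 2 * (Q + 2) ^ (d + 1) ≤ (Q + 2) ^ (d + 1 + 3) := by
      rw [pow_add _ (d + 1), mul_comm]
      exact Nat.mul_le_mul_left _ (by
        calc 2 ≤ 2 ^ 3 := by norm_num
          _ ≤ (Q + 2) ^ 3 := Nat.pow_le_pow_left (by omega) 3)
    simp only [Expr.eval, Expr.cost]
    omega
  | add a b iha ihb =>
    obtain ⟨d₁, h₁⟩ := iha
    obtain ⟨d₂, h₂⟩ := ihb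
    exact ⟨_, fun s Q h => binary a b d₁ d₂ s Q _ (h₁ s Q h) (h₂ s Q h) (.inl le_rfl)⟩
  | sub a b iha ihb =>
    obtain ⟨d₁, h₁⟩ := iha
    obtain ⟨d₂, h₂⟩ := ihb
    exact ⟨_, fun s Q h => binary a b d₁ d₂ s Q _ (h₁ s Q h) (h₂ s Q h)
      (.inl ((Nat.sub_le _ _).trans (Nat.le_add_right _ _)))⟩
  | mul a b iha ihb =>
    obtain ⟨d₁, h₁⟩ := iha
    obtain ⟨d₂, h₂⟩ := ihb
    exact ⟨_, fun s Q h => binary a b d₁ d₂ s Q _ (h₁ s Q h) (h₂ s Q h) (.inr le_rfl)⟩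
  | div a b iha ihb =>
    obtain ⟨d₁, h₁⟩ := iha
    obtain ⟨d₂, h₂⟩ := ihb
    exact ⟨_, fun s Q h => binary a b d₁ d₂ s Q _ (h₁ s Q h) (h₂ s Q h)
      (.inl ((Nat.div_le_self _ _).trans (Nat.le_add_right _ _)))⟩

/-- One exponent serves for finitely many expressions. -/
theorem exists_forall_cost_le (l : List Expr) : ∃ d : ℕ, ∀ e ∈ l, ∀ (s : State) (Q : ℕ),
    s.BoundedBy Q → e.cost s ≤ (Q + 2) ^ d := by
  induction l with
  | nil => exact ⟨0, by simp⟩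
  | cons e l ih =>
    obtain ⟨d₁, h₁⟩ := e.exists_eval_cost_le
    obtain ⟨d₂, h₂⟩ := ih
    refine ⟨d₁ + d₂, fun e' he' s Q hs => ?_⟩
    rcases List.mem_cons.1 he' with rfl | he'
    · exact ((h₁ s Q hs).2).trans (Nat.pow_le_pow_right (by omega) (by omega))
    · exact (h₂ e' he' s Q hs).trans (Nat.pow_le_pow_right (by omega) (by omega))

/-- The loop that counts register `4` down to zero and after each decrement executes
`store addr e`. -/
def fill (addr e : Expr) : Prog :=
  .while (.reg 4) (.seq (.set 4 (.sub (.reg 4) (.lit 1))) (.store addr e))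

/-- The effect and the cost of `fill`, where `μ i` is the content of the memory when register `4`
holds `i`. -/
theorem exec_fill (addr e : Expr) (ρ : ℕ → ℕ) (μ : ℕ → ℕ → ℕ) (Q B N : ℕ) (hNQ : N ≤ Q)
    (hμ : ∀ i < N, Function.update (μ (i + 1)) (addr.eval ⟨Function.update ρ 4 i, μ (i + 1)⟩)
      (e.eval ⟨Function.update ρ 4 i, μ (i + 1)⟩) = μ i)
    (hbound : ∀ i ≤ N, ∀ j ≤ N, State.BoundedBy ⟨Function.update ρ 4 i, μ j⟩ Q)
    (hcost : ∀ f ∈ [.reg 4, .sub (.reg 4) (.lit 1), addr, e], ∀ s : State, s.BoundedBy Q →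
      f.cost s ≤ B) :
    ∃ t ≤ (N + 1) * (4 * B + 3),
      Exec (fill addr e) ⟨Function.update ρ 4 N, μ N⟩ t ⟨Function.update ρ 4 0, μ 0⟩ := by
  induction N with
  | zero =>
    refine ⟨_, ?_, Exec.while_false (by simp [Expr.eval])⟩
    have := hcost (.reg 4) (by simp) _ (hbound 0 le_rfl 0 le_rfl)
    omega
  | succ N ih =>
    obtain ⟨t, ht, hexec⟩ := ih (by omega) (fun i hi => hμ i (by omega))
      (fun i hi j hj => hbound i (by omega) j (by omega))
    have hset := Exec.set 4 (.sub (.reg 4) (.lit 1)) ⟨Function.update ρ 4 (N + 1), μ (N + 1)⟩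
    have hs : State.setReg ⟨Function.update ρ 4 (N + 1), μ (N + 1)⟩ 4
        (Expr.eval ⟨Function.update ρ 4 (N + 1), μ (N + 1)⟩ (.sub (.reg 4) (.lit 1))) =
        ⟨Function.update ρ 4 N, μ (N + 1)⟩ := by
      simp [State.setReg, Expr.eval]
    rw [hs] at hset
    have hstore := Exec.store addr e ⟨Function.update ρ 4 N, μ (N + 1)⟩
    rw [State.setMem, hμ N (by omega)] at hstore
    refine ⟨_, ?_, Exec.while_true (by simp [Expr.eval]) (Exec.seq hset hstore) hexec⟩
    have b₁ := hbound (N + 1) le_rfl (N + 1) le_rfl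
    have b₂ := hbound N (by omega) (N + 1) le_rfl
    have c₁ := hcost (.reg 4) (by simp) _ b₁
    have c₂ := hcost (.sub (.reg 4) (.lit 1)) (by simp) _ b₁
    have c₃ := hcost addr (by simp) _ b₂
    have c₄ := hcost e (by simp) _ b₂
    have : (N + 1 + 1) * (4 * B + 3) = (N + 1) * (4 * B + 3) + (4 * B + 3) := by ring
    omega

/-- The registers while the target instance is being written: the first two numbers of the source
in registers `1` and `2`, and the length of the target in register `3`. -/
def workRegs (n m M : ℕ) : ℕ → ℕ :=
  Function.update (Function.update (Function.update (fun _ => 0) 1 n) 2 m) 3 M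

theorem workRegs_le {n m M Q : ℕ} (hn : n ≤ Q) (hm : m ≤ Q) (hM : M ≤ Q) (i : ℕ) :
    workRegs n m M i ≤ Q := by
  unfold workRegs
  simp only [Function.update_apply]
  split_ifs <;> omega

/-- Replaces an input of length `inLen` by a list of length `outLen` whose entry number `a` is the
value of `cell` when `a` is in register `4`. The input is moved out of the way first, to the cells
from number `outLen` on; in the end this copy and the registers are cleared. -/
def rewriteProg (inLen outLen cell : Expr) : Prog :=
  .seq (.set 1 (.load (.lit 0))) <| .seq (.set 2 (.load (.lit 1))) <|
  .seq (.set 3 outLen) <|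
  .seq (.set 4 inLen) <| .seq (fill (.add (.reg 3) (.reg 4)) (.load (.reg 4))) <|
  .seq (.set 4 (.reg 3)) <| .seq (fill (.reg 4) cell) <|
  .seq (.set 4 inLen) <| .seq (fill (.add (.reg 3) (.reg 4)) (.lit 0)) <|
  .seq (.set 3 (.lit 0)) <| .seq (.set 2 (.lit 0)) <| .set 1 (.lit 0)

/-- The effect and the cost of `rewriteProg`. -/
theorem exists_exec_rewriteProg (inLen outLen cell : Expr) : ∃ d : ℕ, ∀ (X Y : List ℕ) (Q : ℕ),
    (∀ s : State, s.reg 1 = X.getD 0 0 → s.reg 2 = X.getD 1 0 → inLen.eval s = X.length) →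
    (∀ s : State, s.reg 1 = X.getD 0 0 → s.reg 2 = X.getD 1 0 → outLen.eval s = Y.length) →
    (∀ s : State, s.reg 1 = X.getD 0 0 → s.reg 2 = X.getD 1 0 → s.reg 3 = Y.length →
      s.reg 4 < Y.length → (∀ b, s.mem (Y.length + b) = X.getD b 0) →
      cell.eval s = Y.getD (s.reg 4) 0) →
    X.length ≤ Y.length → Y.length ≤ Q → (∀ a, X.getD a 0 ≤ Q) → (∀ a, Y.getD a 0 ≤ Q) →
    ∃ t ≤ (Q + 2) ^ d, Exec (rewriteProg inLen outLen cell) (State.init X) t (State.init Y) := by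
  obtain ⟨d, hd⟩ := exists_forall_cost_le [.load (.lit 0), .load (.lit 1), outLen, inLen,
    .add (.reg 3) (.reg 4), .load (.reg 4), .reg 3, .reg 4, cell, .lit 0,
    .sub (.reg 4) (.lit 1)]
  refine ⟨d + 8, fun X Y Q hin hout hcell hXY hYQ hX hY => ?_⟩
  set n := X.getD 0 0 with hn
  set m := X.getD 1 0 with hm
  set M := Y.length with hM
  have hX0 : ∀ a, X.length ≤ a → X.getD a 0 = 0 := fun a ha => List.getD_eq_default _ _ ha
  have hY0 : ∀ a, M ≤ a → Y.getD a 0 = 0 := fun a ha => List.getD_eq_default _ _ ha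
  have hnQ : n ≤ Q := hX 0
  have hmQ : m ≤ Q := hX 1
  set ρ := workRegs n m M with hρ
  have ρ1 : ρ 1 = n := by simp [hρ, workRegs]
  have ρ2 : ρ 2 = m := by simp [hρ, workRegs]
  have ρ3 : ρ 3 = M := by simp [hρ, workRegs]
  have regBound : ∀ i ≤ Q, ∀ l, Function.update ρ 4 i l ≤ Q := by
    intro i hi l
    rw [Function.update_apply]
    split_ifs
    exacts [hi, workRegs_le hnQ hmQ hYQ l]
  -- The contents of the memory during the three loops.
  set μ₁ : ℕ → ℕ → ℕ := fun i a => if M + i ≤ a then X.getD (a - M) 0 else X.getD a 0 with hμ₁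
  set μ₂ : ℕ → ℕ → ℕ := fun i a => if M ≤ a then X.getD (a - M) 0 else
    if i ≤ a then Y.getD a 0 else X.getD a 0 with hμ₂
  set μ₃ : ℕ → ℕ → ℕ := fun i a => if M ≤ a then (if a < M + i then X.getD (a - M) 0 else 0) else
    Y.getD a 0 with hμ₃
  have μ₁len : μ₁ X.length = fun a => X.getD a 0 := by
    funext a
    simp only [hμ₁]
    split_ifs with h
    · rw [hX0 _ (by omega), hX0 _ (by omega)]
    · rfl
  have μ₂len : μ₂ M = μ₁ 0 := by
    funext a
    simp only [hμ₁, hμ₂, add_zero]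
    split_ifs <;> rfl
  have μ₃len : μ₃ X.length = μ₂ 0 := by
    funext a
    simp only [hμ₂, hμ₃, Nat.zero_le, if_true]
    split_ifs
    · rfl
    · rw [hX0 _ (by omega)]
    · rfl
  have μ₃zero : μ₃ 0 = fun a => Y.getD a 0 := by
    funext a
    simp only [hμ₃]
    split_ifs
    · omega
    · rw [hY0 _ (by omega)]
    · rfl
  have bd₁ : ∀ i ≤ Q, ∀ j, State.BoundedBy ⟨Function.update ρ 4 i, μ₁ j⟩ Q := by
    refine fun i hi j => ⟨regBound i hi, fun a => ?_⟩
    simp only [hμ₁]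
    split_ifs
    exacts [hX _, hX _]
  have bd₂ : ∀ i ≤ Q, ∀ j, State.BoundedBy ⟨Function.update ρ 4 i, μ₂ j⟩ Q := by
    refine fun i hi j => ⟨regBound i hi, fun a => ?_⟩
    simp only [hμ₂]
    split_ifs
    exacts [hX _, hY _, hX _]
  have bd₃ : ∀ i ≤ Q, ∀ j, State.BoundedBy ⟨Function.update ρ 4 i, μ₃ j⟩ Q := by
    refine fun i hi j => ⟨regBound i hi, fun a => ?_⟩
    simp only [hμ₃]
    split_ifs
    exacts [hX _, Nat.zero_le _, hY _]
  have hXQ : X.length ≤ Q := hXY.trans hYQ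
  obtain ⟨t₁, ht₁, e₁⟩ := exec_fill (.add (.reg 3) (.reg 4)) (.load (.reg 4)) ρ μ₁ Q
    ((Q + 2) ^ d) X.length hXQ (by
      intro i hi
      funext a
      simp only [Expr.eval, Function.update_apply, hμ₁, ρ3]
      split_ifs <;> first | omega | congr 1; omega)
    (fun i hi j _ => bd₁ i (by omega) j)
    (fun f hf s hs => hd f (by simp at hf ⊢; tauto) s Q hs)
  obtain ⟨t₂, ht₂, e₂⟩ := exec_fill (.reg 4) cell ρ μ₂ Q ((Q + 2) ^ d) M hYQ (by
      intro i hi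
      rw [hcell _ (by simp [ρ1]) (by simp [ρ2]) (by simp [ρ3]) (by simpa using hi)
        (by intro b; simp [hμ₂])]
      funext a
      simp only [Expr.eval, Function.update_apply, hμ₂]
      split_ifs <;> first | omega | congr 1; omega)
    (fun i hi j _ => bd₂ i (by omega) j)
    (fun f hf s hs => hd f (by simp at hf ⊢; tauto) s Q hs)
  obtain ⟨t₃, ht₃, e₃⟩ := exec_fill (.add (.reg 3) (.reg 4)) (.lit 0) ρ μ₃ Q ((Q + 2) ^ d)
    X.length hXQ (by
      intro i hi
      funext a
      simp only [Expr.eval, Function.update_apply, hμ₃, ρ3]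
      split_ifs <;> omega)
    (fun i hi j _ => bd₃ i (by omega) j)
    (fun f hf s hs => hd f (by simp at hf ⊢; tauto) s Q hs)
  rw [μ₁len] at e₁
  rw [μ₂len] at e₂
  rw [μ₃len, μ₃zero] at e₃
  have setStep : ∀ (i : ℕ) (e : Expr) (s s' : State), e ∈ [.load (.lit 0), .load (.lit 1), outLen,
      inLen, .add (.reg 3) (.reg 4), .load (.reg 4), .reg 3, .reg 4, cell, .lit 0,
      .sub (.reg 4) (.lit 1)] → s.BoundedBy Q → s.setReg i (e.eval s) = s' →
      ∃ t ≤ 1 + (Q + 2) ^ d, Exec (.set i e) s t s' := by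
    rintro i e s s' he hs rfl
    exact ⟨_, Nat.add_le_add_left (hd e he s Q hs) _, Exec.set i e s⟩
  have bd : ∀ (reg : ℕ → ℕ), (∀ i, reg i ≤ Q) → State.BoundedBy ⟨reg, fun a => X.getD a 0⟩ Q :=
    fun reg h => ⟨h, hX⟩
  have bdY : ∀ (reg : ℕ → ℕ), (∀ i, reg i ≤ Q) → State.BoundedBy ⟨reg, fun a => Y.getD a 0⟩ Q :=
    fun reg h => ⟨h, hY⟩
  have hupd : ∀ (reg : ℕ → ℕ) (i v : ℕ), (∀ l, reg l ≤ Q) → v ≤ Q →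
      ∀ l, Function.update reg i v l ≤ Q := by
    intro reg i v h hv l
    rw [Function.update_apply]
    split_ifs
    exacts [hv, h l]
  have hρQ : ∀ i, ρ i ≤ Q := workRegs_le hnQ hmQ hYQ
  obtain ⟨u₁, hu₁, f₁⟩ := setStep 1 (.load (.lit 0)) (State.init X)
    ⟨Function.update (fun _ => 0) 1 n, fun a => X.getD a 0⟩ (by simp)
    (bd _ fun _ => Nat.zero_le _) rfl
  obtain ⟨u₂, hu₂, f₂⟩ := setStep 2 (.load (.lit 1))
    ⟨Function.update (fun _ => 0) 1 n, fun a => X.getD a 0⟩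
    ⟨Function.update (Function.update (fun _ => 0) 1 n) 2 m, fun a => X.getD a 0⟩ (by simp)
    (bd _ (hupd _ _ _ (fun _ => Nat.zero_le _) hnQ)) rfl
  obtain ⟨u₃, hu₃, f₃⟩ := setStep 3 outLen
    ⟨Function.update (Function.update (fun _ => 0) 1 n) 2 m, fun a => X.getD a 0⟩
    ⟨ρ, fun a => X.getD a 0⟩ (by simp)
    (bd _ (hupd _ _ _ (hupd _ _ _ (fun _ => Nat.zero_le _) hnQ) hmQ))
    (by rw [hout _ (by simp) (by simp)]; rfl)
  obtain ⟨u₄, hu₄, f₄⟩ := setStep 4 inLen ⟨ρ, fun a => X.getD a 0⟩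
    ⟨Function.update ρ 4 X.length, fun a => X.getD a 0⟩ (by simp) (bd _ hρQ)
    (by rw [hin _ ρ1 ρ2]; rfl)
  obtain ⟨u₅, hu₅, f₅⟩ := setStep 4 (.reg 3) ⟨Function.update ρ 4 0, μ₁ 0⟩
    ⟨Function.update ρ 4 M, μ₁ 0⟩ (by simp) (bd₁ 0 (Nat.zero_le _) 0)
    (by simp [State.setReg, Expr.eval, ρ3])
  obtain ⟨u₆, hu₆, f₆⟩ := setStep 4 inLen ⟨Function.update ρ 4 0, μ₂ 0⟩
    ⟨Function.update ρ 4 X.length, μ₂ 0⟩ (by simp) (bd₂ 0 (Nat.zero_le _) 0)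
    (by rw [hin _ (by simp [ρ1]) (by simp [ρ2])]; simp [State.setReg])
  obtain ⟨u₇, hu₇, f₇⟩ := setStep 3 (.lit 0) ⟨Function.update ρ 4 0, fun a => Y.getD a 0⟩
    ⟨Function.update (Function.update ρ 4 0) 3 0, fun a => Y.getD a 0⟩ (by simp)
    (bdY _ (hupd _ _ _ hρQ (Nat.zero_le _))) rfl
  obtain ⟨u₈, hu₈, f₈⟩ := setStep 2 (.lit 0)
    ⟨Function.update (Function.update ρ 4 0) 3 0, fun a => Y.getD a 0⟩
    ⟨Function.update (Function.update (Function.update ρ 4 0) 3 0) 2 0, fun a => Y.getD a 0⟩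
    (by simp) (bdY _ (hupd _ _ _ (hupd _ _ _ hρQ (Nat.zero_le _)) (Nat.zero_le _))) rfl
  obtain ⟨u₉, hu₉, f₉⟩ := setStep 1 (.lit 0)
    ⟨Function.update (Function.update (Function.update ρ 4 0) 3 0) 2 0, fun a => Y.getD a 0⟩
    (State.init Y) (by simp)
    (bdY _ (hupd _ _ _ (hupd _ _ _ (hupd _ _ _ hρQ (Nat.zero_le _)) (Nat.zero_le _))
      (Nat.zero_le _)))
    (by
      simp only [State.setReg, State.init, State.mk.injEq, and_true]
      funext i
      simp only [Function.update_apply, hρ, workRegs, Expr.eval]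
      split_ifs <;> rfl)
  refine ⟨_, ?_, f₁.seq <| f₂.seq <| f₃.seq <| f₄.seq <| e₁.seq <| f₅.seq <| e₂.seq <|
    f₆.seq <| e₃.seq <| f₇.seq <| f₈.seq f₉⟩
  set P := (Q + 2) ^ d with hP
  have hP1 : 1 ≤ P := Nat.one_le_pow _ _ (by omega)
  have hloop : ∀ N ≤ Q, (N + 1) * (4 * P + 3) ≤ (Q + 2) * (7 * P) :=
    fun N hN => Nat.mul_le_mul (by omega) (by omega)
  have h₁ := hloop _ hXQ
  have h₂ := hloop _ hYQ
  have h₃ : P ≤ (Q + 2) * P := Nat.le_mul_of_pos_left _ (by omega)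
  have h₄ : (Q + 2) * (7 * P) = 7 * ((Q + 2) * P) := by ring
  have h₅ : 64 * ((Q + 2) * P) ≤ (Q + 2) ^ (d + 8) := by
    calc 64 * ((Q + 2) * P) = 2 ^ 6 * ((Q + 2) * P) := by norm_num
      _ ≤ (Q + 2) ^ 7 * ((Q + 2) * P) := Nat.mul_le_mul_right _
          ((Nat.pow_le_pow_left (by omega) 6).trans (Nat.pow_le_pow_right (by omega) (by omega)))
      _ = (Q + 2) ^ (d + 8) := by rw [hP]; ring
  omega

/-- An instance-wise reduction that `rewriteProg` carries out transfers decidability; the running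
time grows by a polynomial in any bound `Q` for the numbers that occur. -/
theorem DecidableInTime.reduce {α β : Type*} {encA : α → List ℕ} {encB : β → List ℕ}
    {L : α → Prop} {L' : β → Prop} {T : β → ℝ} (h : DecidableInTime encB L' T)
    (f : α → β) (hL : ∀ x, L' (f x) ↔ L x) (inLen outLen cell : Expr) (Q : α → ℕ)
    (hin : ∀ x (s : State), s.reg 1 = (encA x).getD 0 0 → s.reg 2 = (encA x).getD 1 0 →
      inLen.eval s = (encA x).length)
    (hout : ∀ x (s : State), s.reg 1 = (encA x).getD 0 0 → s.reg 2 = (encA x).getD 1 0 →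
      outLen.eval s = (encB (f x)).length)
    (hcell : ∀ x (s : State), s.reg 1 = (encA x).getD 0 0 → s.reg 2 = (encA x).getD 1 0 →
      s.reg 3 = (encB (f x)).length → s.reg 4 < (encB (f x)).length →
      (∀ b, s.mem ((encB (f x)).length + b) = (encA x).getD b 0) →
      cell.eval s = (encB (f x)).getD (s.reg 4) 0)
    (hle : ∀ x, (encA x).length ≤ (encB (f x)).length) (hQ : ∀ x, (encB (f x)).length ≤ Q x)
    (hQA : ∀ x a, (encA x).getD a 0 ≤ Q x) (hQB : ∀ x a, (encB (f x)).getD a 0 ≤ Q x) :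
    ∃ d : ℕ, DecidableInTime encA L fun x => ((Q x : ℝ) + 2) ^ d + T (f x) := by
  obtain ⟨p, hp⟩ := h
  obtain ⟨d, hd⟩ := exists_exec_rewriteProg inLen outLen cell
  refine ⟨d, (rewriteProg inLen outLen cell).seq p, fun x => ?_⟩
  obtain ⟨t₂, s, h₂, ht₂, hs⟩ := hp (f x)
  obtain ⟨t₁, ht₁, h₁⟩ := hd (encA x) (encB (f x)) (Q x) (hin x) (hout x) (hcell x) (hle x) (hQ x)
    (hQA x) (hQB x)
  refine ⟨_, s, h₁.seq h₂, ?_, hs.trans (hL x)⟩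
  push_cast
  exact add_le_add (by exact_mod_cast ht₁) ht₂

end RAM

/-! ### Parity identities for binary digits -/

/-- The binary digit of weight `2 ^ t` of `g`, as an element of the field with two elements. -/
def bit (t g : ℕ) : ZMod 2 := ((g / 2 ^ t % 2 : ℕ) : ZMod 2)

theorem bit_eq_testBit (t g : ℕ) : bit t g = ((g.testBit t).toNat : ZMod 2) := by
  rw [bit, Nat.toNat_testBit]

theorem bit_xor_of_ne {t b : ℕ} (h : t ≠ b) (g : ℕ) : bit t (g ^^^ 2 ^ b) = bit t g := by
  rw [bit_eq_testBit, bit_eq_testBit, Nat.testBit_xor, Nat.testBit_two_pow_of_ne (Ne.symm h),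
    Bool.xor_false]

theorem bit_xor_self (b g : ℕ) : bit b (g ^^^ 2 ^ b) = 1 + bit b g := by
  rw [bit_eq_testBit, bit_eq_testBit, Nat.testBit_xor, Nat.testBit_two_pow_self]
  cases g.testBit b <;> decide

theorem xor_two_pow_div {b k : ℕ} (h : b < k) (g : ℕ) : (g ^^^ 2 ^ b) / 2 ^ k = g / 2 ^ k := by
  rw [← Nat.shiftRight_eq_div_pow, Nat.shiftRight_xor_distrib, Nat.shiftRight_eq_div_pow,
    Nat.shiftRight_eq_div_pow, Nat.div_eq_of_lt (Nat.pow_lt_pow_right (by norm_num) h),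
    Nat.xor_zero]

theorem xor_two_pow_lt {b k M g : ℕ} (h : b < k) (hg : g < M * 2 ^ k) :
    g ^^^ 2 ^ b < M * 2 ^ k := by
  rw [← Nat.div_lt_iff_lt_mul (by positivity)] at hg ⊢
  rwa [xor_two_pow_div h]

theorem xor_two_pow_ne (b g : ℕ) : g ^^^ 2 ^ b ≠ g := by
  intro h
  have := bit_xor_self b g
  rw [h] at this
  revert this
  generalize bit b g = z
  revert z
  decide

theorem xor_two_pow_cancel (b g : ℕ) : (g ^^^ 2 ^ b) ^^^ 2 ^ b = g := by
  rw [Nat.xor_assoc, Nat.xor_self, Nat.xor_zero]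

/-- Flipping a third digit shows that any two digits are simultaneously one an even number of
times. -/
theorem sum_bit_mul_bit {k : ℕ} (hk : 3 ≤ k) (M t s : ℕ) (B : ℕ → ZMod 2) :
    ∑ g ∈ Finset.range (M * 2 ^ k), bit t g * bit s g * B (g / 2 ^ k) = 0 := by
  obtain ⟨b, hb, hbt, hbs⟩ : ∃ b < k, t ≠ b ∧ s ≠ b := by
    by_cases h0 : t ≠ 0 ∧ s ≠ 0
    · exact ⟨0, by omega, h0⟩
    by_cases h1 : t ≠ 1 ∧ s ≠ 1
    · exact ⟨1, by omega, h1⟩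
    · exact ⟨2, by omega, by omega, by omega⟩
  refine Finset.sum_involution (fun g _ => g ^^^ 2 ^ b) (fun g _ => ?_) (fun g _ _ => ?_)
    (fun g hg => ?_) (fun g _ => ?_)
  · rw [bit_xor_of_ne hbt, bit_xor_of_ne hbs, xor_two_pow_div hb]
    exact CharTwo.add_self_eq_zero _
  · exact xor_two_pow_ne b g
  · exact Finset.mem_range.2 (xor_two_pow_lt hb (Finset.mem_range.1 hg))
  · exact xor_two_pow_cancel b g

theorem bit_mul_self (t g : ℕ) : bit t g * bit t g = bit t g := by
  generalize bit t g = z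
  revert z
  decide

theorem sum_bit {k : ℕ} (hk : 3 ≤ k) (M t : ℕ) (B : ℕ → ZMod 2) :
    ∑ g ∈ Finset.range (M * 2 ^ k), bit t g * B (g / 2 ^ k) = 0 := by
  simpa only [bit_mul_self] using sum_bit_mul_bit hk M t t B

/-- The orthogonality behind the clause gadgets: the vector of the affine functionals
`1 + c * ∑ s, bit s g * y s` is orthogonal to that of every linear functional. -/
theorem sum_linear_mul_affine {k : ℕ} (hk : 3 ≤ k) (M : ℕ) (c : ZMod 2) (A y : ℕ → ℕ → ZMod 2) :
    ∑ g ∈ Finset.range (M * 2 ^ k), (∑ t ∈ Finset.range k, bit t g * A t (g / 2 ^ k)) *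
      (1 + c * ∑ s ∈ Finset.range k, bit s g * y s (g / 2 ^ k)) = 0 := by
  have h : ∀ g, (∑ t ∈ Finset.range k, bit t g * A t (g / 2 ^ k)) *
      (1 + c * ∑ s ∈ Finset.range k, bit s g * y s (g / 2 ^ k)) =
      ∑ t ∈ Finset.range k, (bit t g * A t (g / 2 ^ k) + ∑ s ∈ Finset.range k,
        bit t g * bit s g * (c * A t (g / 2 ^ k) * y s (g / 2 ^ k))) := by
    intro g
    rw [Finset.sum_mul]
    refine Finset.sum_congr rfl fun t _ => ?_
    rw [mul_add, mul_one, Finset.mul_sum, Finset.mul_sum]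
    congr 1
    exact Finset.sum_congr rfl fun s _ => by ring
  simp_rw [h]
  rw [Finset.sum_comm]
  refine Finset.sum_eq_zero fun t _ => ?_
  rw [Finset.sum_add_distrib, sum_bit hk, zero_add, Finset.sum_comm]
  exact Finset.sum_eq_zero fun s _ =>
    sum_bit_mul_bit hk M t s fun j => c * A t j * y s j

theorem zmod_two_val_add_val_one_add (z : ZMod 2) : z.val + (1 + z).val = 1 := by
  revert z
  decide

/-- Among the `2 ^ k` affine functionals `1 + ∑ s ∈ T, y s`, all take the value one if `y = 0`, and
exactly half of them do otherwise. -/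
theorem sum_val_affine {k : ℕ} (hk : 1 ≤ k) (y : ℕ → ZMod 2) :
    ∑ T ∈ Finset.range (2 ^ k), (1 + ∑ s ∈ Finset.range k, bit s T * y s).val =
      2 ^ (k - 1) + if ∀ s < k, y s = 0 then 2 ^ (k - 1) else 0 := by
  have hpow : 2 ^ k = 2 ^ (k - 1) + 2 ^ (k - 1) := by
    rw [← mul_two, ← pow_succ, Nat.sub_add_cancel hk]
  split_ifs with h
  · rw [Finset.sum_congr rfl (g := fun _ => 1)]
    · rw [Finset.sum_const, Finset.card_range, smul_eq_mul, mul_one, hpow]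
    · intro T _
      rw [Finset.sum_eq_zero, add_zero]
      · rfl
      · intro s hs
        rw [h s (Finset.mem_range.1 hs), mul_zero]
  · push Not at h
    obtain ⟨b, hb, hy⟩ := h
    have hyb : y b = 1 := by
      revert hy
      generalize y b = z
      revert z
      decide
    set F : ℕ → ZMod 2 := fun T => ∑ s ∈ Finset.range k, bit s T * y s with hF
    have hflip : ∀ T, F (T ^^^ 2 ^ b) = 1 + F T := by
      intro T
      simp only [hF]
      rw [← Finset.add_sum_erase _ _ (Finset.mem_range.2 hb),
        ← Finset.add_sum_erase _ (fun s => bit s T * y s) (Finset.mem_range.2 hb),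
        bit_xor_self, hyb, mul_one, mul_one, ← add_assoc]
      congr 1
      refine Finset.sum_congr rfl fun s hs => ?_
      rw [bit_xor_of_ne (Finset.ne_of_mem_erase hs)]
    have hlt : ∀ T, T < 2 ^ k → T ^^^ 2 ^ b < 2 ^ k := fun T hT =>
      Nat.xor_lt_two_pow hT (Nat.pow_lt_pow_right (by norm_num) hb)
    have heq : ∑ T ∈ Finset.range (2 ^ k), (1 + F T).val =
        ∑ T ∈ Finset.range (2 ^ k), (F T).val := by
      refine Finset.sum_nbij' (fun T => T ^^^ 2 ^ b) (fun T => T ^^^ 2 ^ b) ?_ ?_ ?_ ?_ ?_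
      · exact fun T hT => Finset.mem_range.2 (hlt T (Finset.mem_range.1 hT))
      · exact fun T hT => Finset.mem_range.2 (hlt T (Finset.mem_range.1 hT))
      · exact fun T _ => xor_two_pow_cancel b T
      · exact fun T _ => xor_two_pow_cancel b T
      · intro T _
        rw [hflip]
    have hsum : ∑ T ∈ Finset.range (2 ^ k), (F T).val +
        ∑ T ∈ Finset.range (2 ^ k), (1 + F T).val = 2 ^ k := by
      rw [← Finset.sum_add_distrib]
      simp [zmod_two_val_add_val_one_add]
    change ∑ T ∈ Finset.range (2 ^ k), (1 + F T).val = 2 ^ (k - 1) + 0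
    omega

/-! ### Sums over blocks -/

theorem sum_range_mul {A : Type*} [AddCommMonoid A] (M K : ℕ) (f : ℕ → A) :
    ∑ g ∈ Finset.range (M * K), f g =
      ∑ j ∈ Finset.range M, ∑ T ∈ Finset.range K, f (j * K + T) := by
  induction M with
  | zero => simp
  | succ M ih => rw [Nat.succ_mul, Finset.sum_range_add, ih, Finset.sum_range_succ]

/-! ### The signal along a wire -/

/-- The value at position `p` of a wire whose first vertex has the value `a`. For `r = 1` the wire
carries `a, 1 + a, 0, a, 1 + a, 0, …`, for `r = 2` it carries
`a, 1, 1 + a, 0, a, 1, 1 + a, 0, …`. -/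
def wireVal (r : ℕ) (a : ZMod 2) (p : ℕ) : ZMod 2 :=
  if p % (r + 2) = 0 then a else if p % (r + 2) = r then 1 + a else
    if p % (r + 2) = r + 1 then 0 else 1

theorem wireVal_add_mul (r j p : ℕ) (a : ZMod 2) :
    wireVal r a ((r + 2) * j + p) = wireVal r a p := by
  simp [wireVal]

theorem wireVal_zero (r : ℕ) (a : ZMod 2) : wireVal r a 0 = a := by
  simp [wireVal]

theorem wireVal_self {r : ℕ} (hr : r = 1 ∨ r = 2) (a : ZMod 2) : wireVal r a r = 1 + a := by
  rcases hr with rfl | rfl <;> simp [wireVal]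

theorem wireVal_start {r : ℕ} (hr : r = 1 ∨ r = 2) (a : ZMod 2) :
    r * wireVal r a 0 + wireVal r a 1 = 1 := by
  rcases hr with rfl | rfl <;> revert a <;> decide

theorem wireVal_step {r : ℕ} (hr : r = 1 ∨ r = 2) (a : ZMod 2) (p : ℕ) :
    r * wireVal r a (p + 1) + wireVal r a (p + 2) + wireVal r a p = 1 := by
  have hp : p = (r + 2) * (p / (r + 2)) + p % (r + 2) := (Nat.div_add_mod _ _).symm
  have hlt : p % (r + 2) < r + 2 := Nat.mod_lt _ (by omega)
  rw [hp]
  generalize p % (r + 2) = s at *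
  rw [add_assoc _ s 1, add_assoc _ s 2, wireVal_add_mul, wireVal_add_mul, wireVal_add_mul]
  clear hp
  rcases hr with rfl | rfl <;> interval_cases s <;> revert a <;> decide

theorem wireVal_end {r : ℕ} (hr : r = 1 ∨ r = 2) (a : ZMod 2) (m : ℕ) :
    r * wireVal r a ((r + 2) * m + r) + wireVal r a ((r + 2) * m + (r - 1)) = 1 := by
  rw [wireVal_add_mul, wireVal_add_mul]
  rcases hr with rfl | rfl <;> revert a <;> decide

/-- The number of ones on a wire does not depend on the value that it carries. -/
theorem sum_val_wireVal {r : ℕ} (hr : r = 1 ∨ r = 2) (a : ZMod 2) (m : ℕ) :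
    ∑ p ∈ Finset.range ((r + 2) * m + r + 1), (wireVal r a p).val = r * (m + 1) := by
  have h : ∀ l, ∑ p ∈ Finset.range l, (wireVal r a ((r + 2) * m + p)).val =
      ∑ p ∈ Finset.range l, (wireVal r a p).val := fun l => by simp only [wireVal_add_mul]
  rw [add_assoc, Finset.sum_range_add, h, mul_comm, sum_range_mul]
  simp only [mul_comm _ (r + 2), wireVal_add_mul, Finset.sum_const, Finset.card_range, smul_eq_mul]
  rcases hr with rfl | rfl
  · rw [show ∑ p ∈ Finset.range (1 + 2), (wireVal 1 a p).val = 1 by clear h; revert a; decide,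
      show ∑ p ∈ Finset.range (1 + 1), (wireVal 1 a p).val = 1 by clear h; revert a; decide]
    ring
  · rw [show ∑ p ∈ Finset.range (2 + 2), (wireVal 2 a p).val = 2 by clear h; revert a; decide,
      show ∑ p ∈ Finset.range (2 + 1), (wireVal 2 a p).val = 2 by clear h; revert a; decide]
    ring

/-! ### The graph of a formula -/

/-- The data from which the graph is built: `n` variables, `m` clauses of `k` literals, the code
`code (k * j + t)` of the literal number `t` of clause number `j` (twice the variable, plus one if
the literal is positive), and the problem: `r = 1` for Reflexive-AllOff, `r = 2` for AllOff.
The vertices are natural numbers. First come the `n` wires, one for each variable; the vertex at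
position `p` of wire `i` is `p * n + i`. They are followed by the gates, one for each pair of a
clause `j` and a set `T ⊆ {0, …, k - 1}` of literals in it, numbered `j * 2 ^ k + T` with `T` read
as a binary number; a further block `j = m` of gates that are not attached to anything makes sure
that the graph is not empty. If `r = 2`, each gate has a leaf, and the leaves come last. -/
structure Layout where
  n : ℕ
  m : ℕ
  k : ℕ
  r : ℕ
  code : ℕ → ℕ

namespace Layout

variable (l : Layout)

/-- The conditions under which the graph encodes the formula. -/
structure Valid : Prop where
  three_le : 3 ≤ l.k
  problem : l.r = 1 ∨ l.r = 2
  code_lt : ∀ j < l.m, ∀ t < l.k, l.code (l.k * j + t) / 2 < l.n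

/-- The number of wire vertices. -/
def wires : ℕ := l.n * ((l.r + 2) * l.m + l.r + 1)

/-- The number of gates. -/
def gates : ℕ := (l.m + 1) * 2 ^ l.k

/-- The number of vertices. -/
def order : ℕ := l.wires + l.r * l.gates

/-- The wire vertex that carries the value of literal `t` of clause `j`. -/
def target (j t : ℕ) : ℕ :=
  l.code (l.k * j + t) / 2 + l.n * ((l.r + 2) * j + l.r * (1 - l.code (l.k * j + t) % 2))

/-- This number is `1` if the wire vertex `u` is adjacent to gate `g`, and `0` otherwise. A literal
that occurs twice in the set of the gate cancels. -/
def attach (u g : ℕ) : ℕ :=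
  if g / 2 ^ l.k < l.m then
    (∑ t ∈ Finset.range l.k, g / 2 ^ t % 2 * if l.target (g / 2 ^ l.k) t = u then 1 else 0) % 2
  else 0

/-- The edges, each in the direction of increasing numbers. -/
def Arc (u v : ℕ) : Prop :=
  if u < l.wires then
    if v < l.wires then u + l.n = v else v < l.wires + l.gates ∧ l.attach u (v - l.wires) = 1
  else u + l.gates = v

/-- Adjacency of the vertices `u` and `v`. -/
def Adj (u v : ℕ) : Prop := l.Arc u v ∨ l.Arc v u

open Classical in
/-- Membership in the solution set, written as a system of linear equations. The diagonal entry
`r` is the difference between the two problems. -/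
def IsSol (x : ℕ → ZMod 2) : Prop :=
  ∀ v < l.order, l.r * x v + ∑ u ∈ Finset.range l.order, (if l.Adj v u then x u else 0) = 1

/-- The sum of the values `x` of the literals that belong to gate `g`. -/
def gateSum (x : ℕ → ZMod 2) (g : ℕ) : ZMod 2 :=
  ∑ t ∈ Finset.range l.k,
    bit t g * if g / 2 ^ l.k < l.m then x (l.target (g / 2 ^ l.k) t) else 0

variable {l}

theorem gates_pos : 0 < l.gates := by
  unfold gates
  positivity

theorem attach_eq_zero_or_one (u g : ℕ) : l.attach u g = 0 ∨ l.attach u g = 1 := by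
  unfold attach
  split_ifs
  · exact Nat.mod_two_eq_zero_or_one _
  · exact .inl rfl

theorem cast_attach (u g : ℕ) : (l.attach u g : ZMod 2) = ∑ t ∈ Finset.range l.k,
    bit t g * if g / 2 ^ l.k < l.m ∧ l.target (g / 2 ^ l.k) t = u then 1 else 0 := by
  unfold attach
  split_ifs with h
  · rw [ZMod.natCast_mod, Nat.cast_sum]
    refine Finset.sum_congr rfl fun t _ => ?_
    simp [bit, h]
  · simp [h]

theorem attach_ite (u g : ℕ) (z : ZMod 2) :
    (if l.attach u g = 1 then z else 0) = l.attach u g * z := by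
  rcases attach_eq_zero_or_one (l := l) u g with h | h <;> simp [h]

theorem target_lt (hl : l.Valid) {j t : ℕ} (hj : j < l.m) (ht : t < l.k) :
    l.target j t < l.wires := by
  have h₁ := hl.code_lt j hj t ht
  unfold target wires
  generalize l.code (l.k * j + t) = c at *
  have h₂ : (l.r + 2) * j + l.r * (1 - c % 2) + 1 ≤ (l.r + 2) * l.m + l.r + 1 := by
    have : (l.r + 2) * j ≤ (l.r + 2) * l.m := Nat.mul_le_mul_left _ hj.le
    have : l.r * (1 - c % 2) ≤ l.r * 1 := Nat.mul_le_mul_left _ (by omega)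
    omega
  have h₃ := Nat.mul_le_mul_left l.n h₂
  rw [mul_add, mul_one] at h₃
  omega

theorem sum_attach_mul (hl : l.Valid) (x : ℕ → ZMod 2) (g : ℕ) :
    ∑ u ∈ Finset.range l.wires, (l.attach u g : ZMod 2) * x u = l.gateSum x g := by
  simp_rw [cast_attach, gateSum, Finset.sum_mul]
  rw [Finset.sum_comm]
  refine Finset.sum_congr rfl fun t ht => ?_
  simp_rw [mul_assoc, ← Finset.mul_sum]
  congr 1
  by_cases h : g / 2 ^ l.k < l.m
  · simp [h, target_lt hl h (Finset.mem_range.1 ht)]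
  · simp [h]

/-- The gates do not disturb the equation of a wire vertex, because the values of all gates at this
vertex add up to zero. -/
theorem sum_attach_affine (hl : l.Valid) (c : ZMod 2) (x : ℕ → ZMod 2) (u : ℕ) :
    ∑ g ∈ Finset.range l.gates, (l.attach u g : ZMod 2) * (1 + c * l.gateSum x g) = 0 := by
  simp_rw [cast_attach, gateSum]
  exact sum_linear_mul_affine hl.three_le (l.m + 1) c
    (fun t j => if j < l.m ∧ l.target j t = u then 1 else 0)
    (fun t j => if j < l.m then x (l.target j t) else 0)

theorem sum_order (hr : l.r = 1 ∨ l.r = 2) {A : Type*} [AddCommMonoid A] (f : ℕ → A) :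
    ∑ u ∈ Finset.range l.order, f u = ∑ u ∈ Finset.range l.wires, f u +
      (∑ g ∈ Finset.range l.gates, f (l.wires + g) +
        if l.r = 2 then ∑ g ∈ Finset.range l.gates, f (l.wires + l.gates + g) else 0) := by
  unfold order
  rcases hr with h | h
  · simp [h, Finset.sum_range_add]
  · simp [h, Finset.sum_range_add, two_mul, add_assoc]

theorem adj_wire_wire {u v : ℕ} (hu : u < l.wires) (hv : v < l.wires) :
    l.Adj u v ↔ u + l.n = v ∨ v + l.n = u := by
  simp [Adj, Arc, hu, hv]

theorem adj_wire_gate {u g : ℕ} (hu : u < l.wires) (hg : g < l.gates) :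
    l.Adj u (l.wires + g) ↔ l.attach u g = 1 := by
  have h₁ : ¬ l.wires + g + l.gates = u := by omega
  simp [Adj, Arc, hu, hg, h₁]

theorem not_adj_wire_leaf {u : ℕ} (hu : u < l.wires) (g : ℕ) :
    ¬ l.Adj u (l.wires + l.gates + g) := by
  have h₁ : ¬ l.wires + l.gates + g + l.gates = u := by omega
  have h₂ : ¬ l.wires + l.gates + g < l.wires := by omega
  simp [Adj, Arc, hu, h₁, h₂]

theorem adj_comm (u v : ℕ) : l.Adj u v ↔ l.Adj v u := or_comm

theorem not_adj_gate_gate {g g' : ℕ} (hg : g < l.gates) (hg' : g' < l.gates) :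
    ¬ l.Adj (l.wires + g) (l.wires + g') := by
  have h₁ : ¬ l.wires + g + l.gates = l.wires + g' := by omega
  have h₂ : ¬ l.wires + g' + l.gates = l.wires + g := by omega
  simp [Adj, Arc, h₁, h₂]

theorem adj_gate_leaf {g g' : ℕ} (hg : g < l.gates) :
    l.Adj (l.wires + g) (l.wires + l.gates + g') ↔ g = g' := by
  have h₁ : ¬ l.wires + l.gates + g' + l.gates = l.wires + g := by omega
  have h₂ : ¬ l.wires + l.gates + g' < l.wires := by omega
  simp only [Adj, Arc, h₁, h₂]
  simp
  omega

theorem not_adj_leaf_leaf {g g' : ℕ} (hg : g < l.gates) (hg' : g' < l.gates) :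
    ¬ l.Adj (l.wires + l.gates + g) (l.wires + l.gates + g') := by
  have h₁ : ¬ l.wires + l.gates + g + l.gates = l.wires + l.gates + g' := by omega
  have h₂ : ¬ l.wires + l.gates + g' + l.gates = l.wires + l.gates + g := by omega
  have h₃ : ¬ l.wires + l.gates + g < l.wires := by omega
  have h₄ : ¬ l.wires + l.gates + g' < l.wires := by omega
  simp [Adj, Arc, h₁, h₂, h₃, h₄]

/-- The equation of a wire vertex. -/
def WireEq (l : Layout) (x : ℕ → ZMod 2) (v : ℕ) : Prop :=
  l.r * x v + ((if v + l.n < l.wires then x (v + l.n) else 0) +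
    (if l.n ≤ v then x (v - l.n) else 0)) = 1

open Classical in
theorem sum_adj_wire (hl : l.Valid) (x : ℕ → ZMod 2) {v : ℕ} (hv : v < l.wires) :
    ∑ u ∈ Finset.range l.order, (if l.Adj v u then x u else 0) =
      ((if v + l.n < l.wires then x (v + l.n) else 0) + (if l.n ≤ v then x (v - l.n) else 0)) +
        ∑ g ∈ Finset.range l.gates, (l.attach v g : ZMod 2) * x (l.wires + g) := by
  have hn : 0 < l.n := by
    rcases Nat.eq_zero_or_pos l.n with h | h
    · simp [wires, h] at hv
    · exact h
  rw [sum_order hl.problem]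
  congr 1
  · have h : ∀ u ∈ Finset.range l.wires, (if l.Adj v u then x u else 0) =
        (if v + l.n = u then x u else 0) + (if l.n ≤ v ∧ v - l.n = u then x u else 0) := by
      intro u hu
      rw [Finset.mem_range] at hu
      rw [adj_wire_wire hv hu]
      split_ifs <;> first | omega | simp
    rw [Finset.sum_congr rfl h, Finset.sum_add_distrib]
    congr 1
    · simp
    · by_cases hnv : l.n ≤ v
      · have : v - l.n < l.wires := by omega
        simp [hnv, this]
      · simp [hnv]
  · rw [Finset.sum_congr rfl (g := fun g => (l.attach v g : ZMod 2) * x (l.wires + g)),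
      Finset.sum_eq_zero (s := Finset.range l.gates)
        (f := fun g => if l.Adj v (l.wires + l.gates + g) then x (l.wires + l.gates + g) else 0)]
    · simp
    · intro g _
      rw [if_neg (not_adj_wire_leaf hv g)]
    · intro g hg
      rw [← attach_ite]
      simp only [adj_wire_gate hv (Finset.mem_range.1 hg)]

open Classical in
theorem sum_adj_gate (hl : l.Valid) (x : ℕ → ZMod 2) {g : ℕ} (hg : g < l.gates) :
    ∑ u ∈ Finset.range l.order, (if l.Adj (l.wires + g) u then x u else 0) =
      l.gateSum x g + if l.r = 2 then x (l.wires + l.gates + g) else 0 := by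
  rw [sum_order hl.problem, Finset.sum_congr rfl (g := fun u => (l.attach u g : ZMod 2) * x u),
    sum_attach_mul hl, Finset.sum_eq_zero (s := Finset.range l.gates), zero_add]
  · simp only [adj_gate_leaf hg]
    simp [hg]
  · intro g' hg'
    rw [if_neg (not_adj_gate_gate hg (Finset.mem_range.1 hg'))]
  · intro u hu
    rw [← attach_ite, adj_comm]
    simp only [adj_wire_gate (Finset.mem_range.1 hu) hg]

open Classical in
theorem sum_adj_leaf (hl : l.Valid) (hr : l.r = 2) (x : ℕ → ZMod 2) {g : ℕ} (hg : g < l.gates) :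
    ∑ u ∈ Finset.range l.order, (if l.Adj (l.wires + l.gates + g) u then x u else 0) =
      x (l.wires + g) := by
  rw [sum_order hl.problem, Finset.sum_eq_zero (s := Finset.range l.wires), if_pos hr,
    Finset.sum_eq_zero (s := Finset.range l.gates)
      (f := fun g' => if l.Adj (l.wires + l.gates + g) (l.wires + l.gates + g') then
        x (l.wires + l.gates + g') else 0), zero_add, add_zero]
  · rw [Finset.sum_congr rfl (g := fun g' => if g' = g then x (l.wires + g') else 0)]
    · simp [hg]
    · intro g' hg'
      rw [adj_comm]
      simp only [adj_gate_leaf (Finset.mem_range.1 hg')]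
  · intro g' hg'
    rw [if_neg (not_adj_leaf_leaf hg (Finset.mem_range.1 hg'))]
  · intro u hu
    rw [adj_comm, if_neg (not_adj_wire_leaf (Finset.mem_range.1 hu) g)]

/-- The gate equations determine the gates and, if present, their leaves from the wires; then the
equations of the wire vertices are those of isolated paths. -/
theorem isSol_iff (hl : l.Valid) (x : ℕ → ZMod 2) : l.IsSol x ↔
    (∀ v < l.wires, l.WireEq x v) ∧
    (∀ g < l.gates, x (l.wires + g) = if l.r = 2 then 1 else 1 + l.gateSum x g) ∧
    (l.r = 2 → ∀ g < l.gates, x (l.wires + l.gates + g) = 1 + l.gateSum x g) := by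
  have char2 : ∀ a b c : ZMod 2, a + b = c ↔ a = c + b := by decide
  have hcast : (l.r : ZMod 2) = if l.r = 2 then 0 else 1 := by
    rcases hl.problem with h | h <;> rw [h] <;> decide
  have hquiet : (∀ g < l.gates, x (l.wires + g) = if l.r = 2 then 1 else 1 + l.gateSum x g) →
      ∀ v, ∑ g ∈ Finset.range l.gates, (l.attach v g : ZMod 2) * x (l.wires + g) = 0 := by
    intro h v
    rw [← sum_attach_affine hl (if l.r = 2 then 0 else 1) x v]
    refine Finset.sum_congr rfl fun g hg => ?_
    rw [h g (Finset.mem_range.1 hg)]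
    split_ifs <;> simp
  constructor
  · intro h
    have hleaf : l.r = 2 → ∀ g < l.gates, x (l.wires + g) = 1 := by
      intro hr g hg
      have := h (l.wires + l.gates + g) (by rw [order, hr]; omega)
      rw [sum_adj_leaf hl hr x hg, hcast, if_pos hr, zero_mul, zero_add] at this
      exact this
    have hgate : ∀ g < l.gates, (l.r : ZMod 2) * x (l.wires + g) +
        (l.gateSum x g + if l.r = 2 then x (l.wires + l.gates + g) else 0) = 1 := by
      intro g hg
      rw [← sum_adj_gate hl x hg]
      refine h _ ?_
      rw [order]
      rcases hl.problem with hr | hr <;> rw [hr] <;> omega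
    have hgate' : ∀ g < l.gates,
        x (l.wires + g) = if l.r = 2 then 1 else 1 + l.gateSum x g := by
      intro g hg
      split_ifs with hr
      · exact hleaf hr g hg
      · have := hgate g hg
        rwa [hcast, if_neg hr, if_neg hr, one_mul, add_zero, char2] at this
    refine ⟨fun v hv => ?_, hgate', fun hr g hg => ?_⟩
    · have := h v (by rw [order]; omega)
      rw [sum_adj_wire hl x hv, hquiet hgate', add_zero] at this
      exact this
    · have := hgate g hg
      rwa [hcast, if_pos hr, if_pos hr, zero_mul, zero_add, add_comm, char2] at this
  · rintro ⟨hwire, hgate, hleaf⟩ v hv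
    by_cases h₁ : v < l.wires
    · rw [sum_adj_wire hl x h₁, hquiet hgate, add_zero]
      exact hwire v h₁
    by_cases h₂ : v < l.wires + l.gates
    · obtain ⟨g, rfl⟩ := Nat.exists_eq_add_of_le (not_lt.1 h₁)
      have hg : g < l.gates := by omega
      rw [sum_adj_gate hl x hg, hgate g hg, hcast]
      split_ifs with hr
      · rw [hleaf hr g hg]
        generalize l.gateSum x g = z
        revert z; decide
      · generalize l.gateSum x g = z
        revert z; decide
    · obtain ⟨g, rfl⟩ := Nat.exists_eq_add_of_le (not_lt.1 h₂)
      have hr : l.r = 2 := by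
        refine hl.problem.resolve_left fun hr => ?_
        rw [order, hr] at hv
        omega
      have hg : g < l.gates := by
        rw [order, hr] at hv
        omega
      rw [sum_adj_leaf hl hr x hg, hgate g hg, hcast, if_pos hr, if_pos hr, zero_mul, zero_add]

end Layout

/-! ### The solutions and their sizes -/

namespace Layout

/-- The value of the literal with code `c` under the assignment `a`. -/
def litVal (a : ℕ → ZMod 2) (c : ℕ) : ZMod 2 := if c % 2 = 1 then a (c / 2) else 1 + a (c / 2)

variable {l : Layout}

/-- The sum of the values of the literals that belong to gate `g`. -/
def litSum (l : Layout) (a : ℕ → ZMod 2) (g : ℕ) : ZMod 2 :=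
  ∑ t ∈ Finset.range l.k,
    bit t g * if g / 2 ^ l.k < l.m then litVal a (l.code (l.k * (g / 2 ^ l.k) + t)) else 0

/-- The solution that corresponds to the assignment `a`. -/
def sol (l : Layout) (a : ℕ → ZMod 2) (v : ℕ) : ZMod 2 :=
  if v < l.wires then wireVal l.r (a (v % l.n)) (v / l.n) else
  if v < l.wires + l.gates then (if l.r = 2 then 1 else 1 + l.litSum a (v - l.wires)) else
  1 + l.litSum a (v - (l.wires + l.gates))

/-- Some assignment makes a literal of each clause true. -/
def Sat (l : Layout) : Prop :=
  ∃ a : ℕ → ZMod 2, ∀ j < l.m, ∃ t < l.k, litVal a (l.code (l.k * j + t)) = 1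

/-- The size of the solutions that correspond to satisfying assignments. -/
def budget (l : Layout) : ℕ :=
  l.n * (l.r * (l.m + 1)) + ((l.r - 1) * l.gates + (l.m * 2 ^ (l.k - 1) + 2 ^ l.k))

theorem mul_add_lt_wires {p i : ℕ} (hi : i < l.n) :
    p * l.n + i < l.wires ↔ p < (l.r + 2) * l.m + l.r + 1 := by
  rw [wires, mul_comm l.n, ← Nat.div_lt_iff_lt_mul (by omega), mul_comm p,
    Nat.mul_add_div (by omega), Nat.div_eq_of_lt hi, add_zero]

theorem sol_wire (a : ℕ → ZMod 2) {p i : ℕ} (hi : i < l.n)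
    (hp : p < (l.r + 2) * l.m + l.r + 1) : l.sol a (p * l.n + i) = wireVal l.r (a i) p := by
  rw [sol, if_pos ((mul_add_lt_wires hi).2 hp), mul_comm p, Nat.mul_add_mod, Nat.mod_eq_of_lt hi,
    Nat.mul_add_div (by omega), Nat.div_eq_of_lt hi, add_zero]

theorem sol_target (hl : l.Valid) (a : ℕ → ZMod 2) {j t : ℕ} (hj : j < l.m) (ht : t < l.k) :
    l.sol a (l.target j t) = litVal a (l.code (l.k * j + t)) := by
  have h₁ := target_lt hl hj ht
  have h₂ := hl.code_lt j hj t ht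
  unfold target at *
  generalize l.code (l.k * j + t) = c at *
  rw [add_comm, mul_comm l.n] at *
  rw [sol_wire a h₂ ((mul_add_lt_wires h₂).1 h₁), wireVal_add_mul, litVal]
  rcases Nat.mod_two_eq_zero_or_one c with h | h <;> rw [h]
  · simpa using wireVal_self hl.problem _
  · simpa using wireVal_zero _ _

theorem gateSum_eq_litSum (hl : l.Valid) {x a : ℕ → ZMod 2}
    (h : ∀ v < l.wires, x v = l.sol a v) (g : ℕ) : l.gateSum x g = l.litSum a g := by
  refine Finset.sum_congr rfl fun t ht => ?_
  congr 1
  split_ifs with hg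
  · rw [h _ (target_lt hl hg (Finset.mem_range.1 ht)), sol_target hl a hg (Finset.mem_range.1 ht)]
  · rfl

theorem wireEq_sol (hl : l.Valid) (a : ℕ → ZMod 2) {v : ℕ} (hv : v < l.wires) :
    l.WireEq (l.sol a) v := by
  have hn : 0 < l.n := by
    rcases Nat.eq_zero_or_pos l.n with h | h
    · simp [wires, h] at hv
    · exact h
  obtain ⟨p, i, hi, rfl⟩ : ∃ p i, i < l.n ∧ p * l.n + i = v :=
    ⟨v / l.n, v % l.n, Nat.mod_lt _ hn, Nat.div_add_mod' _ _⟩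
  have hp := (mul_add_lt_wires hi).1 hv
  have hnext : p * l.n + i + l.n = (p + 1) * l.n + i := by ring
  have hr0 : 1 ≤ l.r := by rcases hl.problem with h | h <;> omega
  rw [WireEq, hnext, sol_wire a hi hp]
  rcases p with _ | p
  · rw [if_pos ((mul_add_lt_wires hi).2 (by omega)), if_neg (by omega), sol_wire a hi (by omega),
      add_zero]
    exact wireVal_start hl.problem _
  · have hprev : (p + 1) * l.n + i - l.n = p * l.n + i := by
      rw [Nat.add_mul, one_mul]
      omega
    have hle : l.n ≤ (p + 1) * l.n + i := by
      rw [Nat.add_mul, one_mul]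
      omega
    rw [if_pos hle, hprev, sol_wire a hi (p := p) (by omega)]
    by_cases hlast : p + 1 + 1 < (l.r + 2) * l.m + l.r + 1
    · rw [if_pos ((mul_add_lt_wires hi).2 hlast), sol_wire a hi hlast, ← add_assoc]
      exact wireVal_step hl.problem _ _
    · rw [if_neg (mt (mul_add_lt_wires hi).1 hlast), zero_add]
      have h₁ : p + 1 = (l.r + 2) * l.m + l.r := by omega
      have h₂ : p = (l.r + 2) * l.m + (l.r - 1) := by omega
      rw [h₁, h₂]
      exact wireVal_end hl.problem _ _

theorem isSol_sol (hl : l.Valid) (a : ℕ → ZMod 2) : l.IsSol (l.sol a) := by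
  rw [isSol_iff hl]
  refine ⟨fun v hv => wireEq_sol hl a hv, fun g hg => ?_, fun hr g hg => ?_⟩
  · rw [gateSum_eq_litSum hl (fun _ _ => rfl), sol, if_neg (by omega), if_pos (by omega),
      Nat.add_sub_cancel_left]
  · rw [gateSum_eq_litSum hl (fun _ _ => rfl), sol, if_neg (by omega), if_neg (by omega),
      Nat.add_sub_cancel_left]

/-- A solution is determined by its values at the first vertices of the wires. -/
theorem IsSol.eq_sol (hl : l.Valid) {x : ℕ → ZMod 2} (hx : l.IsSol x) :
    ∀ v < l.order, x v = l.sol x v := by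
  rw [isSol_iff hl] at hx
  obtain ⟨hwire, hgate, hleaf⟩ := hx
  have move : ∀ a b c d : ZMod 2, a + b = 1 → c + d = 1 → a = c → b = d := by decide
  have hr0 : 1 ≤ l.r := by rcases hl.problem with h | h <;> omega
  have step : ∀ i < l.n, ∀ p, (p < (l.r + 2) * l.m + l.r + 1 →
      x (p * l.n + i) = wireVal l.r (x i) p) ∧ (p + 1 < (l.r + 2) * l.m + l.r + 1 →
      x ((p + 1) * l.n + i) = wireVal l.r (x i) (p + 1)) := by
    intro i hi p
    induction p with
    | zero =>
      refine ⟨fun _ => by simp [wireVal_zero], fun hp => ?_⟩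
      have h := hwire (0 * l.n + i) ((mul_add_lt_wires hi).2 (by omega))
      have hnext : 0 * l.n + i + l.n = (0 + 1) * l.n + i := by ring
      rw [WireEq, hnext, if_pos ((mul_add_lt_wires hi).2 hp), if_neg (by omega), add_zero] at h
      refine move _ _ _ _ h (wireVal_start hl.problem (x i)) ?_
      rw [zero_mul, zero_add, wireVal_zero]
    | succ p ih =>
      obtain ⟨ih₀, ih₁⟩ := ih
      refine ⟨ih₁, fun hp => ?_⟩
      have h := hwire ((p + 1) * l.n + i) ((mul_add_lt_wires hi).2 (by omega))
      have hnext : (p + 1) * l.n + i + l.n = (p + 1 + 1) * l.n + i := by ring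
      have hprev : (p + 1) * l.n + i - l.n = p * l.n + i := by
        rw [Nat.add_mul, one_mul]
        omega
      have hle : l.n ≤ (p + 1) * l.n + i := by
        rw [Nat.add_mul, one_mul]
        omega
      rw [WireEq, hnext, if_pos ((mul_add_lt_wires hi).2 hp), if_pos hle, hprev, ih₀ (by omega),
        ih₁ (by omega), add_left_comm, add_comm] at h
      have h' := wireVal_step hl.problem (x i) p
      rw [add_right_comm] at h'
      exact move _ _ _ _ h h' rfl
  have hw : ∀ v < l.wires, x v = l.sol x v := by
    intro v hv
    have hn : 0 < l.n := by
      rcases Nat.eq_zero_or_pos l.n with h | h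
      · simp [wires, h] at hv
      · exact h
    obtain ⟨p, i, hi, rfl⟩ : ∃ p i, i < l.n ∧ p * l.n + i = v :=
      ⟨v / l.n, v % l.n, Nat.mod_lt _ hn, Nat.div_add_mod' _ _⟩
    have hp := (mul_add_lt_wires hi).1 hv
    rw [sol_wire x hi hp]
    exact (step i hi p).1 hp
  intro v hv
  by_cases h₁ : v < l.wires
  · exact hw v h₁
  by_cases h₂ : v < l.wires + l.gates
  · obtain ⟨g, rfl⟩ := Nat.exists_eq_add_of_le (not_lt.1 h₁)
    rw [hgate g (by omega), gateSum_eq_litSum hl hw, sol, if_neg h₁, if_pos h₂,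
      Nat.add_sub_cancel_left]
  · obtain ⟨g, rfl⟩ := Nat.exists_eq_add_of_le (not_lt.1 h₂)
    have hr : l.r = 2 := by
      refine hl.problem.resolve_left fun hr => ?_
      rw [order, hr] at hv
      omega
    rw [order, hr] at hv
    rw [hleaf hr g (by omega), gateSum_eq_litSum hl hw, sol, if_neg h₁, if_neg h₂,
      Nat.add_sub_cancel_left]

theorem sum_val_litSum (hl : l.Valid) (a : ℕ → ZMod 2) :
    ∑ g ∈ Finset.range l.gates, (1 + l.litSum a g).val = l.m * 2 ^ (l.k - 1) + 2 ^ l.k +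
      2 ^ (l.k - 1) * ((Finset.range l.m).filter
        fun j => ∀ t < l.k, litVal a (l.code (l.k * j + t)) = 0).card := by
  have hk : 1 ≤ l.k := by have := hl.three_le; omega
  have hblock : ∀ j, ∑ T ∈ Finset.range (2 ^ l.k), (1 + l.litSum a (j * 2 ^ l.k + T)).val =
      2 ^ (l.k - 1) + if ∀ t < l.k,
        (if j < l.m then litVal a (l.code (l.k * j + t)) else 0) = 0 then 2 ^ (l.k - 1) else 0 := by
    intro j
    rw [← sum_val_affine hk]
    refine Finset.sum_congr rfl fun T hT => ?_
    have hdiv : (j * 2 ^ l.k + T) / 2 ^ l.k = j := by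
      rw [mul_comm, Nat.mul_add_div (by positivity),
        Nat.div_eq_of_lt (Finset.mem_range.1 hT), add_zero]
    rw [litSum]
    congr 2
    refine Finset.sum_congr rfl fun t ht => ?_
    rw [hdiv]
    congr 1
    rw [bit_eq_testBit, bit_eq_testBit, mul_comm j,
      Nat.testBit_two_pow_mul_add _ (Finset.mem_range.1 hT), if_pos (Finset.mem_range.1 ht)]
  rw [gates, sum_range_mul, Finset.sum_range_succ, hblock l.m]
  have hpow : 2 ^ l.k = 2 ^ (l.k - 1) + 2 ^ (l.k - 1) := by
    rw [← mul_two, ← pow_succ, Nat.sub_add_cancel hk]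
  have hsum : ∑ j ∈ Finset.range l.m,
      ∑ T ∈ Finset.range (2 ^ l.k), (1 + l.litSum a (j * 2 ^ l.k + T)).val =
      ∑ j ∈ Finset.range l.m, (2 ^ (l.k - 1) + if ∀ t < l.k,
        litVal a (l.code (l.k * j + t)) = 0 then 2 ^ (l.k - 1) else 0) := by
    refine Finset.sum_congr rfl fun j hj => ?_
    rw [hblock]
    simp only [Finset.mem_range.1 hj, if_true]
  rw [hsum, Finset.sum_add_distrib, ← Finset.sum_filter]
  simp only [lt_irrefl, if_false, implies_true, if_true, Finset.sum_const, Finset.card_range,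
    smul_eq_mul]
  rw [hpow]
  ring

/-- The size of the solution that corresponds to `a`. -/
theorem sum_val_sol (hl : l.Valid) (a : ℕ → ZMod 2) :
    ∑ v ∈ Finset.range l.order, (l.sol a v).val = l.budget +
      2 ^ (l.k - 1) * ((Finset.range l.m).filter
        fun j => ∀ t < l.k, litVal a (l.code (l.k * j + t)) = 0).card := by
  have hwire : ∑ v ∈ Finset.range l.wires, (l.sol a v).val = l.n * (l.r * (l.m + 1)) := by
    rw [wires, mul_comm l.n, sum_range_mul, Finset.sum_comm]
    rw [Finset.sum_congr rfl (g := fun _ => l.r * (l.m + 1)), Finset.sum_const,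
      Finset.card_range, smul_eq_mul]
    intro i hi
    rw [← sum_val_wireVal hl.problem (a i) l.m]
    refine Finset.sum_congr rfl fun p hp => ?_
    rw [sol_wire a (Finset.mem_range.1 hi) (Finset.mem_range.1 hp)]
  rw [sum_order hl.problem, hwire, budget, add_assoc (l.n * _), add_assoc, ← sum_val_litSum hl a]
  congr 1
  have hgate : ∀ g ∈ Finset.range l.gates, (l.sol a (l.wires + g)).val =
      (if l.r = 2 then 1 else 1 + l.litSum a g : ZMod 2).val := by
    intro g hg
    rw [Finset.mem_range] at hg
    rw [sol, if_neg (by omega), if_pos (by omega), Nat.add_sub_cancel_left]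
  have hleaf : ∀ g ∈ Finset.range l.gates, (l.sol a (l.wires + l.gates + g)).val =
      (1 + l.litSum a g).val := by
    intro g _
    rw [sol, if_neg (by omega), if_neg (by omega), Nat.add_sub_cancel_left]
  rw [Finset.sum_congr rfl hgate, Finset.sum_congr rfl hleaf]
  rcases hl.problem with hr | hr
  · simp [hr]
  · simp [hr, ZMod.val_one]

theorem exists_isSol (hl : l.Valid) (h : l.Sat) :
    ∃ x, l.IsSol x ∧ ∑ v ∈ Finset.range l.order, (x v).val = l.budget := by
  obtain ⟨a, ha⟩ := h
  refine ⟨l.sol a, isSol_sol hl a, ?_⟩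
  rw [sum_val_sol hl, Finset.filter_eq_empty_iff.2, Finset.card_empty, mul_zero, add_zero]
  intro j hj hall
  obtain ⟨t, ht, h1⟩ := ha j (Finset.mem_range.1 hj)
  rw [hall t ht] at h1
  exact absurd h1 (by decide)

theorem sat_of_isSol (hl : l.Valid) {x : ℕ → ZMod 2} (hx : l.IsSol x)
    (hsize : ∑ v ∈ Finset.range l.order, (x v).val ≤ l.budget) : l.Sat := by
  rw [Finset.sum_congr rfl fun v hv => congrArg ZMod.val
    (IsSol.eq_sol hl hx v (Finset.mem_range.1 hv)), sum_val_sol hl] at hsize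
  have hpos : 0 < 2 ^ (l.k - 1) := by positivity
  have hcard := (Nat.mul_eq_zero.1 (Nat.eq_zero_of_le_zero
    ((add_le_iff_nonpos_right _).1 hsize))).resolve_left hpos.ne'
  rw [Finset.card_eq_zero, Finset.filter_eq_empty_iff] at hcard
  refine ⟨x, fun j hj => ?_⟩
  have := hcard (Finset.mem_range.2 hj)
  push Not at this
  obtain ⟨t, ht, h⟩ := this
  refine ⟨t, ht, ?_⟩
  revert h
  generalize litVal x _ = z
  revert z
  decide

theorem budget_le_order (hl : l.Valid) : l.budget ≤ l.order := by
  have hk : 2 ^ (l.k - 1) ≤ 2 ^ l.k := Nat.pow_le_pow_right (by omega) (by omega)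
  have h₁ : l.m * 2 ^ (l.k - 1) ≤ l.m * 2 ^ l.k := Nat.mul_le_mul_left _ hk
  have h₂ : l.r * (l.m + 1) ≤ (l.r + 2) * l.m + l.r + 1 := by nlinarith
  have h₃ := Nat.mul_le_mul_left l.n h₂
  have h₄ : l.m * 2 ^ l.k + 2 ^ l.k = l.gates := by rw [gates]; ring
  rw [budget, order, wires]
  rcases hl.problem with hr | hr <;> simp only [hr] at * <;> omega

end Layout

/-! ### The instance: graph, path decomposition and encoding -/

namespace Layout

variable {l : Layout}

theorem Valid.m_eq_zero (hl : l.Valid) (hn : l.n = 0) : l.m = 0 := by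
  by_contra h
  have := hl.code_lt 0 (Nat.pos_of_ne_zero h) 0 (by have := hl.three_le; omega)
  omega

theorem Valid.r_pos (hl : l.Valid) : 1 ≤ l.r := by
  rcases hl.problem with h | h <;> omega

theorem not_adj_self (u : ℕ) : ¬ l.Adj u u := by
  have hG := gates_pos (l := l)
  have h : ¬ l.Arc u u := by
    intro h
    unfold Arc at h
    split_ifs at h with h₁
    · have hn : l.n = 0 := by omega
      rw [wires, hn, zero_mul] at h₁
      omega
    · omega
  exact fun h' => h'.elim h h

theorem gates_le_order (hl : l.Valid) : l.gates ≤ l.order := by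
  have := Nat.mul_le_mul_right l.gates hl.r_pos
  rw [order]
  omega

/-- The graph of a layout. -/
def graph (l : Layout) : SimpleGraph (Fin l.order) where
  Adj u v := l.Adj u v
  symm := ⟨fun u v h => (adj_comm (l := l) (u : ℕ) v).1 h⟩
  loopless := ⟨fun u h => not_adj_self (u : ℕ) h⟩

/-- Membership of the vertex `v` in bag `τ`: a window of `n + 1` wire vertices from number `τ` on
moves over the wires, accompanied by all gates and leaves of the clause to which position
`τ / n` of the wires belongs. -/
def InBag (l : Layout) (τ v : ℕ) : Prop :=
  if v < l.wires then τ ≤ v ∧ v ≤ τ + l.n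
  else (v - l.wires) % l.gates / 2 ^ l.k = τ / ((l.r + 2) * l.n)

theorem exists_bag_block (hl : l.Valid) {j : ℕ} (hj : j ≤ l.m) :
    ∃ τ ≤ l.wires, τ / ((l.r + 2) * l.n) = j := by
  rcases Nat.eq_zero_or_pos l.n with hn | hn
  · have := hl.m_eq_zero hn
    refine ⟨0, Nat.zero_le _, ?_⟩
    rw [Nat.zero_div]
    omega
  · refine ⟨j * ((l.r + 2) * l.n), ?_, Nat.mul_div_cancel _ (by positivity)⟩
    calc j * ((l.r + 2) * l.n) = l.n * ((l.r + 2) * j) := by ring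
      _ ≤ l.n * ((l.r + 2) * l.m + l.r + 1) := Nat.mul_le_mul_left _
        (le_trans (Nat.mul_le_mul_left _ hj) (by omega))

theorem gate_block_le {g : ℕ} : g % l.gates / 2 ^ l.k ≤ l.m := by
  have h := Nat.mod_lt g (gates_pos (l := l))
  rw [gates, ← Nat.div_lt_iff_lt_mul (by positivity)] at h
  rw [gates]
  omega

/-- The bag whose first vertex is the target of a literal belongs to the clause of this literal. -/
theorem target_div (hl : l.Valid) {j t : ℕ} (hj : j < l.m) (ht : t < l.k) :
    l.target j t / ((l.r + 2) * l.n) = j := by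
  have h := hl.code_lt j hj t ht
  have hn : 0 < l.n := by omega
  unfold target
  generalize l.code (l.k * j + t) = c at *
  have hc : l.r * (1 - c % 2) ≤ l.r * 1 := Nat.mul_le_mul_left _ (by omega)
  rw [show c / 2 + l.n * ((l.r + 2) * j + l.r * (1 - c % 2)) =
    (l.r + 2) * l.n * j + (l.n * (l.r * (1 - c % 2)) + c / 2) by ring,
    Nat.mul_add_div (by positivity), Nat.div_eq_of_lt, add_zero]
  have := Nat.mul_le_mul_left l.n hc
  have : (l.r + 2) * l.n = l.n * (l.r * 1) + 2 * l.n := by ring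
  omega

theorem exists_target_of_attach {u g : ℕ} (h : l.attach u g = 1) :
    g / 2 ^ l.k < l.m ∧ ∃ t < l.k, l.target (g / 2 ^ l.k) t = u := by
  unfold attach at h
  split_ifs at h with hj
  refine ⟨hj, ?_⟩
  by_contra hne
  push Not at hne
  rw [Finset.sum_eq_zero] at h
  · simp at h
  · intro t ht
    rw [if_neg (hne t (Finset.mem_range.1 ht)), mul_zero]

/-- Both ends of an edge occur in a common bag. -/
theorem exists_bag_of_arc (hl : l.Valid) {u v : ℕ} (h : l.Arc u v) :
    ∃ τ ≤ l.wires, l.InBag τ u ∧ l.InBag τ v := by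
  unfold Arc at h
  split_ifs at h with hu hv
  · refine ⟨u, hu.le, ?_, ?_⟩
    · simp [InBag, hu]
    · rw [InBag, if_pos hv]
      omega
  · obtain ⟨hj, t, ht, htu⟩ := exists_target_of_attach h.2
    refine ⟨u, hu.le, ?_, ?_⟩
    · simp [InBag, hu]
    · rw [InBag, if_neg hv, Nat.mod_eq_of_lt (by omega), ← htu, target_div hl hj ht]
  · obtain ⟨τ, hτ, h'⟩ := exists_bag_block hl (gate_block_le (l := l) (g := u - l.wires))
    refine ⟨τ, hτ, ?_, ?_⟩
    · rw [InBag, if_neg hu, h']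
    · rw [InBag, if_neg (by omega), h', ← h, Nat.sub_add_comm (by omega), Nat.add_mod_right]

open Classical in
/-- The path decomposition of the graph of a layout. -/
noncomputable def decomp (l : Layout) (hl : l.Valid) : PathDecomposition l.graph where
  length := l.wires + 1
  bag τ := Finset.univ.filter fun v => l.InBag τ v
  vertex_mem v := by
    by_cases hv : (v : ℕ) < l.wires
    · exact ⟨⟨v, by omega⟩, by simp [InBag, hv]⟩
    · obtain ⟨τ, hτ, h⟩ := exists_bag_block hl (gate_block_le (l := l) (g := v - l.wires))
      exact ⟨⟨τ, by omega⟩, by simp [InBag, hv, h]⟩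
  edge_mem u v h := by
    rcases h with h | h
    · obtain ⟨τ, hτ, h₁, h₂⟩ := exists_bag_of_arc hl h
      exact ⟨⟨τ, by omega⟩, by simpa using h₁, by simpa using h₂⟩
    · obtain ⟨τ, hτ, h₁, h₂⟩ := exists_bag_of_arc hl h
      exact ⟨⟨τ, by omega⟩, by simpa using h₂, by simpa using h₁⟩
  connected v i j p hij hjp hi hp := by
    rw [Finset.mem_filter_univ] at hi hp ⊢
    unfold InBag at *
    have hij' : (i : ℕ) ≤ j := hij
    have hjp' : (j : ℕ) ≤ p := hjp
    split_ifs at * with hv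
    · omega
    · exact le_antisymm (hi ▸ Nat.div_le_div_right hij') (hp ▸ Nat.div_le_div_right hjp')

theorem mem_bag (hl : l.Valid) (τ : Fin (l.wires + 1)) (v : Fin l.order) :
    v ∈ (l.decomp hl).bag τ ↔ l.InBag τ v := by
  classical
  exact Finset.mem_filter_univ v

/-- One vertex for each variable and a number of further vertices that depends on `k` only. -/
theorem width_decomp_le (hl : l.Valid) : (l.decomp hl).width ≤ l.n + l.r * 2 ^ l.k := by
  classical
  rw [PathDecomposition.width, Nat.sub_le_iff_le_add, Finset.sup_le_iff]
  intro τ _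
  set j := (τ : ℕ) / ((l.r + 2) * l.n) with hj
  have hsub : ((l.decomp hl).bag τ).image Fin.val ⊆ Finset.Icc (τ : ℕ) (τ + l.n) ∪
      (Finset.range l.r ×ˢ Finset.range (2 ^ l.k)).image
        fun q => l.wires + (l.gates * q.1 + (2 ^ l.k * j + q.2)) := by
    intro v hv
    obtain ⟨v, hv', rfl⟩ := Finset.mem_image.1 hv
    have hv : l.InBag τ v := (mem_bag hl τ v).1 hv'
    rw [Finset.mem_union]
    unfold InBag at hv
    split_ifs at hv with h
    · exact .inl (Finset.mem_Icc.2 hv)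
    · refine .inr (Finset.mem_image.2 ⟨((v - l.wires) / l.gates,
        (v - l.wires) % l.gates % 2 ^ l.k), Finset.mem_product.2 ⟨?_, ?_⟩, ?_⟩)
      · rw [Finset.mem_range, Nat.div_lt_iff_lt_mul gates_pos]
        have := v.2
        unfold order at this
        omega
      · exact Finset.mem_range.2 (Nat.mod_lt _ (by positivity))
      · simp only
        rw [hj, ← hv, Nat.div_add_mod, Nat.div_add_mod]
        omega
  calc ((l.decomp hl).bag τ).card = (((l.decomp hl).bag τ).image Fin.val).card :=
        (Finset.card_image_of_injective _ Fin.val_injective).symm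
    _ ≤ _ := Finset.card_le_card hsub
    _ ≤ _ := Finset.card_union_le _ _
    _ ≤ (l.n + 1) + l.r * 2 ^ l.k := by
        refine add_le_add (by simp; omega) (Finset.card_image_le.trans ?_)
        simp
    _ = l.n + l.r * 2 ^ l.k + 1 := by ring

/-- The instance of a layout. -/
noncomputable def inst (l : Layout) (hl : l.Valid) : LightsOutInstance where
  order := l.order
  order_pos := gates_pos.trans_le (gates_le_order hl)
  graph := l.graph
  decomp := l.decomp hl
  length_le := by
    have h₁ := Nat.mul_le_mul_right l.gates hl.r_pos
    have h₂ := gates_pos (l := l)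
    change l.wires + 1 ≤ l.order
    rw [order]
    omega
  size := l.budget
  size_le := budget_le_order hl

open Classical in
theorem cast_card_filter_adj {x : ℕ → ZMod 2} {S : Finset (Fin l.order)}
    (hS : ∀ v, v ∈ S ↔ x v = 1) (v : Fin l.order) :
    ((S.filter fun w => l.graph.Adj v w).card : ZMod 2) =
      ∑ u ∈ Finset.range l.order, if l.Adj v u then x u else 0 := by
  rw [Finset.sum_range, ← Finset.sum_boole, ← Finset.sum_filter_add_sum_filter_not Finset.univ
    (fun u => u ∈ S) (fun u => if l.Adj v u then x u else 0)]
  have h₀ : ∑ u ∈ Finset.univ.filter (fun u => ¬ u ∈ S),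
      (if l.Adj v u then x u else 0) = (0 : ZMod 2) := by
    refine Finset.sum_eq_zero fun u hu => ?_
    have := (not_congr (hS u)).1 (Finset.mem_filter.1 hu).2
    have : x u = 0 := by
      revert this
      generalize x u = z
      revert z
      decide
    rw [this, ite_self]
  rw [h₀, add_zero, Finset.filter_univ_mem]
  refine Finset.sum_congr rfl fun u hu => ?_
  rw [(hS u).1 hu]
  rfl

theorem card_eq_sum_val {x : ℕ → ZMod 2} {S : Finset (Fin l.order)}
    (hS : ∀ v, v ∈ S ↔ x v = 1) : S.card = ∑ v ∈ Finset.range l.order, (x v).val := by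
  have hval : ∀ z : ZMod 2, z.val = if z = 1 then 1 else 0 := by decide
  have hS' : S = Finset.univ.filter fun v : Fin l.order => x v = 1 := by
    ext v
    simp [hS]
  rw [hS', Finset.sum_range, Finset.card_filter]
  exact Finset.sum_congr rfl fun v _ => (hval _).symm

/-- The solutions of Reflexive-AllOff (for `r = 1`) and of AllOff (for `r = 2`) on the graph. -/
def IsSolution (l : Layout) (S : Finset (Fin l.order)) : Prop :=
  if l.r = 1 then IsReflexiveAllOffSolution l.graph S else IsAllOffSolution l.graph S

theorem isSolution_iff (hr : l.r = 1 ∨ l.r = 2) {x : ℕ → ZMod 2} {S : Finset (Fin l.order)}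
    (hS : ∀ v, v ∈ S ↔ x v = 1) : l.IsSolution S ↔ l.IsSol x := by
  classical
  have hx : ∀ v : Fin l.order, v ∉ S → x v = 0 := by
    intro v hv
    have := (not_congr (hS v)).1 hv
    revert this
    generalize x v = z
    revert z
    decide
  have h₁ : l.IsSol x ↔ ∀ v : Fin l.order,
      l.r * x v + ∑ u ∈ Finset.range l.order, (if l.Adj v u then x u else 0) = 1 :=
    ⟨fun h v => h v v.2, fun h v hv => h ⟨v, hv⟩⟩
  rw [h₁]
  simp only [← cast_card_filter_adj hS]
  have hsplit : ∀ σ : Set ℕ, IsSigmaRhoSet l.graph σ {x | Odd x} S ↔ ∀ v,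
      if v ∈ S then (S.filter fun w => l.graph.Adj v w).card ∈ σ
      else Odd (S.filter fun w => l.graph.Adj v w).card := by
    intro σ
    constructor
    · rintro ⟨ha, hb⟩ v
      split_ifs with hv
      · convert ha v hv
      · have : (_ : ℕ) ∈ {x | Odd x} := hb v hv
        rw [Set.mem_ofPred_eq] at this
        convert this
    · intro h
      refine ⟨fun v hv => ?_, fun v hv => ?_⟩
      · have := h v
        rw [if_pos hv] at this
        convert this
      · have := h v
        rw [if_neg hv] at this
        rw [Set.mem_ofPred_eq]
        convert this
  have two : ∀ z : ZMod 2, 1 + z = 1 ↔ z = 0 := by decide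
  rcases hr with hr | hr
  · rw [IsSolution, if_pos hr, IsReflexiveAllOffSolution, hsplit, hr]
    refine forall_congr' fun v => ?_
    split_ifs with hv
    · rw [(hS v).1 hv, Nat.cast_one, one_mul, two, ZMod.natCast_eq_zero_iff_even]
      rfl
    · rw [hx v hv, mul_zero, zero_add, ZMod.natCast_eq_one_iff_odd]
  · rw [IsSolution, if_neg (by omega), IsAllOffSolution, hsplit, hr]
    refine forall_congr' fun v => ?_
    have h20 : ((2 : ℕ) : ZMod 2) = 0 := by decide
    rw [h20, zero_mul, zero_add, ZMod.natCast_eq_one_iff_odd]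
    split_ifs <;> rfl

theorem exists_solution_card_eq (hl : l.Valid) (h : l.Sat) :
    ∃ S, l.IsSolution S ∧ S.card = l.budget := by
  obtain ⟨x, hx, hsize⟩ := exists_isSol hl h
  have hS : ∀ v : Fin l.order, v ∈ Finset.univ.filter (fun v : Fin l.order => x v = 1) ↔ x v = 1 :=
    fun v => by simp
  exact ⟨_, (isSolution_iff hl.problem hS).2 hx, (card_eq_sum_val hS).trans hsize⟩

theorem sat_of_solution (hl : l.Valid) {S : Finset (Fin l.order)} (h : l.IsSolution S)
    (hsize : S.card ≤ l.budget) : l.Sat := by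
  classical
  set x : ℕ → ZMod 2 := fun v => if hv : v < l.order then if ⟨v, hv⟩ ∈ S then 1 else 0 else 0
    with hx
  have hS : ∀ v : Fin l.order, v ∈ S ↔ x v = 1 := by
    intro v
    simp only [hx, v.2, dif_pos]
    split_ifs with hv <;> simp [hv]
  exact sat_of_isSol hl ((isSolution_iff hl.problem hS).1 h) (card_eq_sum_val hS ▸ hsize)

end Layout

theorem length_flatMap_of_length_eq {α β : Type*} {w : ℕ} {f : α → List β}
    (hf : ∀ x, (f x).length = w) (L : List α) : (L.flatMap f).length = L.length * w := by
  simp [List.length_flatMap, hf]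

/-- Entries of a concatenation of lists of equal lengths. -/
theorem getD_flatMap_of_length_eq {α β : Type*} {w : ℕ} {f : α → List β}
    (hf : ∀ x, (f x).length = w) (d : β) (L : List α) {j t : ℕ} (hj : j < L.length) (ht : t < w) :
    (L.flatMap f).getD (j * w + t) d = (f L[j]).getD t d := by
  induction L generalizing j with
  | nil => simp at hj
  | cons x L ih =>
    rw [List.flatMap_cons]
    rcases j with _ | j
    · rw [zero_mul, zero_add, List.getD_append _ _ _ _ (by rw [hf]; exact ht)]
      rfl
    · have : (j + 1) * w + t = j * w + t + w := by ring
      rw [List.getD_append_right _ _ _ _ (by rw [hf]; omega), hf, this, Nat.add_sub_cancel,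
        ih (by simpa using hj)]
      rfl

theorem getD_matrix {N M : ℕ} (f : Fin N → Fin M → ℕ) {j t : ℕ} (hj : j < N) (ht : t < M) :
    ((List.finRange N).flatMap fun u => (List.finRange M).map fun v => f u v).getD (j * M + t) 0 =
      f ⟨j, hj⟩ ⟨t, ht⟩ := by
  rw [getD_flatMap_of_length_eq (w := M) (by simp) _ _ (by simpa using hj) ht,
    List.getD_eq_getElem _ _ (by simpa using ht)]
  simp

namespace Layout

variable {l : Layout}

open Classical in
/-- The entry number `a` of the encoded instance. -/
noncomputable def cell (l : Layout) (a : ℕ) : ℕ :=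
  if a < 3 then if a = 0 then l.order else if a = 1 then l.wires + 1 else l.budget
  else if a - 3 < l.order * l.order then
    if l.Adj ((a - 3) / l.order) ((a - 3) % l.order) then 1 else 0
  else
    if l.InBag ((a - 3 - l.order * l.order) / l.order) ((a - 3 - l.order * l.order) % l.order)
    then 1 else 0

/-- The length of the encoded instance. -/
def outLength (l : Layout) : ℕ := 3 + (l.order * l.order + (l.wires + 1) * l.order)

theorem length_encode_inst (hl : l.Valid) : (l.inst hl).encode.length = l.outLength := by
  unfold LightsOutInstance.encode
  rw [List.length_append, List.length_append, length_flatMap_of_length_eq (w := l.order),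
    length_flatMap_of_length_eq (w := l.order)]
  · simp only [List.length_cons, List.length_nil, List.length_finRange, outLength]
    simp only [inst, decomp]
    ring
  · intro; simp [inst]
  · intro; simp [inst]

theorem getD_encode_inst (hl : l.Valid) {a : ℕ} (ha : a < l.outLength) :
    (l.inst hl).encode.getD a 0 = l.cell a := by
  classical
  have hpos : 0 < l.order := (l.inst hl).order_pos
  unfold LightsOutInstance.encode cell
  rw [List.append_assoc]
  split_ifs with h₁ h₂ h₃ h₄ h₅ h₅
  · subst h₂; rfl
  · subst h₃; rfl
  · obtain rfl : a = 2 := by omega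
    rfl
  all_goals
    rw [List.getD_append_right _ _ _ _ (by simp; omega)]
    have h₃ : a - [(l.inst hl).order, (l.inst hl).decomp.length, (l.inst hl).size].length = a - 3 :=
      rfl
    rw [h₃]
    have hlen : ((List.finRange (l.inst hl).order).flatMap fun u =>
      (List.finRange (l.inst hl).order).map fun v =>
        if (l.inst hl).graph.Adj u v then 1 else 0).length = l.order * l.order := by
      rw [length_flatMap_of_length_eq (w := l.order)]
      · simp [inst]
      · intro; simp [inst]
  iterate 2
    · rw [List.getD_append _ _ _ _ (by rw [hlen]; exact h₄)]
      have hdm : a - 3 = (a - 3) / l.order * l.order + (a - 3) % l.order :=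
        (Nat.div_add_mod' _ _).symm
      rw [hdm]
      refine (getD_matrix _ ((Nat.div_lt_iff_lt_mul hpos).2 h₄) (Nat.mod_lt _ hpos)).trans ?_
      first | exact if_pos h₅ | exact if_neg h₅
  iterate 2
    · rw [List.getD_append_right _ _ _ _ (by rw [hlen]; omega), hlen]
      have hdm : a - 3 - l.order * l.order = (a - 3 - l.order * l.order) / l.order * l.order +
        (a - 3 - l.order * l.order) % l.order := (Nat.div_add_mod' _ _).symm
      rw [hdm]
      have hb : a - 3 - l.order * l.order < (l.wires + 1) * l.order := by
        unfold outLength at ha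
        omega
      refine (getD_matrix _ ((Nat.div_lt_iff_lt_mul hpos).2 hb) (Nat.mod_lt _ hpos)).trans ?_
      first
        | exact if_pos ((mem_bag hl ⟨_, _⟩ ⟨_, _⟩).2 h₅)
        | exact if_neg (mt (mem_bag hl ⟨_, _⟩ ⟨_, _⟩).1 h₅)

end Layout

/-! ### Computing single entries of the instance -/

namespace RAM.Expr

/-- Remainder. -/
def mod (a b : Expr) : Expr := .sub a (.mul b (.div a b))

/-- The test `a < b`, with value `1` or `0`. -/
def lt (a b : Expr) : Expr := .sub (.lit 1) (.sub (.add a (.lit 1)) b)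

/-- The test `a = b`, with value `1` or `0`. -/
def eq (a b : Expr) : Expr := .sub (.lit 1) (.add (.sub a b) (.sub b a))

/-- Case distinction by the value `c` of a test. Both branches are evaluated. -/
def cond (c a b : Expr) : Expr := .add (.mul c a) (.mul (.sub (.lit 1) c) b)

/-- The sum of `f 0, …, f (N - 1)`. -/
def sum (f : ℕ → Expr) : ℕ → Expr
  | 0 => .lit 0
  | N + 1 => .add (sum f N) (f N)

variable (s : State)

@[simp] theorem eval_mod (a b : Expr) : (mod a b).eval s = a.eval s % b.eval s := by
  have := Nat.div_add_mod (a.eval s) (b.eval s)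
  simp only [mod, eval]
  omega

@[simp] theorem eval_lt (a b : Expr) : (lt a b).eval s = if a.eval s < b.eval s then 1 else 0 := by
  simp only [lt, eval]
  split_ifs <;> omega

@[simp] theorem eval_eq (a b : Expr) : (eq a b).eval s = if a.eval s = b.eval s then 1 else 0 := by
  simp only [eq, eval]
  split_ifs <;> omega

theorem eval_cond {c : Expr} {p : Prop} [Decidable p] (hc : c.eval s = if p then 1 else 0)
    (a b : Expr) : (cond c a b).eval s = if p then a.eval s else b.eval s := by
  simp only [cond, eval, hc]
  split_ifs <;> simp

@[simp] theorem eval_sum (f : ℕ → Expr) (N : ℕ) :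
    (sum f N).eval s = ∑ t ∈ Finset.range N, (f t).eval s := by
  induction N with
  | zero => rfl
  | succ N ih => rw [Finset.sum_range_succ, ← ih]; rfl

end RAM.Expr

namespace Layout

open RAM RAM.Expr

/-- The layout that is stored in a machine configuration: the numbers of variables and clauses are
in registers `1` and `2`, and the encoded formula starts at the cell that is named in
register `3`. -/
def ofState (k r : ℕ) (s : State) : Layout :=
  ⟨s.reg 1, s.reg 2, k, r, fun a => s.mem (s.reg 3 + (2 + a))⟩

/-- Computes `wires`. -/
def wiresExpr (r : ℕ) : Expr :=
  .mul (.reg 1) (.add (.add (.mul (.lit (r + 2)) (.reg 2)) (.lit r)) (.lit 1))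

/-- Computes `gates`. -/
def gatesExpr (k : ℕ) : Expr := .mul (.add (.reg 2) (.lit 1)) (.lit (2 ^ k))

/-- Computes `order`. -/
def orderExpr (k r : ℕ) : Expr := .add (wiresExpr r) (.mul (.lit r) (gatesExpr k))

/-- Computes `budget`. -/
def budgetExpr (k r : ℕ) : Expr :=
  .add (.mul (.reg 1) (.mul (.lit r) (.add (.reg 2) (.lit 1))))
    (.add (.mul (.lit (r - 1)) (gatesExpr k))
      (.add (.mul (.reg 2) (.lit (2 ^ (k - 1)))) (.lit (2 ^ k))))

/-- Computes `outLength`. -/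
def outLengthExpr (k r : ℕ) : Expr :=
  .add (.lit 3) (.add (.mul (orderExpr k r) (orderExpr k r))
    (.mul (.add (wiresExpr r) (.lit 1)) (orderExpr k r)))

/-- Computes `code`. -/
def codeExpr (a : Expr) : Expr := .load (.add (.reg 3) (.add (.lit 2) a))

/-- Computes `target`. -/
def targetExpr (k r : ℕ) (j : Expr) (t : ℕ) : Expr :=
  let c := codeExpr (.add (.mul (.lit k) j) (.lit t))
  .add (.div c (.lit 2)) (.mul (.reg 1) (.add (.mul (.lit (r + 2)) j)
    (.mul (.lit r) (.sub (.lit 1) (.mod c (.lit 2))))))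

/-- Computes `attach`. -/
def attachExpr (k r : ℕ) (u g : Expr) : Expr :=
  let j := .div g (.lit (2 ^ k))
  .cond (.lt j (.reg 2)) (.mod (.sum (fun t => .mul (.mod (.div g (.lit (2 ^ t))) (.lit 2))
    (.cond (.eq (targetExpr k r j t) u) (.lit 1) (.lit 0))) k) (.lit 2)) (.lit 0)

/-- Decides `Arc`. -/
def arcExpr (k r : ℕ) (u v : Expr) : Expr :=
  .cond (.lt u (wiresExpr r))
    (.cond (.lt v (wiresExpr r)) (.eq (.add u (.reg 1)) v)
      (.mul (.lt v (.add (wiresExpr r) (gatesExpr k)))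
        (.eq (attachExpr k r u (.sub v (wiresExpr r))) (.lit 1))))
    (.eq (.add u (gatesExpr k)) v)

/-- Decides `Adj`. -/
def adjExpr (k r : ℕ) (u v : Expr) : Expr := .cond (arcExpr k r u v) (.lit 1) (arcExpr k r v u)

/-- Decides `InBag`. -/
def inBagExpr (k r : ℕ) (τ v : Expr) : Expr :=
  .cond (.lt v (wiresExpr r))
    (.mul (.lt τ (.add v (.lit 1))) (.lt v (.add (.add τ (.reg 1)) (.lit 1))))
    (.eq (.div (.mod (.sub v (wiresExpr r)) (gatesExpr k)) (.lit (2 ^ k)))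
      (.div τ (.mul (.lit (r + 2)) (.reg 1))))

/-- Computes `cell` for the number in register `4`. -/
def cellExpr (k r : ℕ) : Expr :=
  let a := .reg 4
  let N := orderExpr k r
  let b := .sub a (.lit 3)
  let c := .sub b (.mul N N)
  .cond (.lt a (.lit 3)) (.cond (.eq a (.lit 0)) N
    (.cond (.eq a (.lit 1)) (.add (wiresExpr r) (.lit 1)) (budgetExpr k r)))
  (.cond (.lt b (.mul N N)) (adjExpr k r (.div b N) (.mod b N))
    (inBagExpr k r (.div c N) (.mod c N)))

variable (k r : ℕ) (s : State)

@[simp] theorem eval_wiresExpr : (wiresExpr r).eval s = (ofState k r s).wires := rfl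

@[simp] theorem eval_gatesExpr : (gatesExpr k).eval s = (ofState k r s).gates := rfl

@[simp] theorem eval_orderExpr : (orderExpr k r).eval s = (ofState k r s).order := rfl

theorem eval_budgetExpr : (budgetExpr k r).eval s = (ofState k r s).budget := rfl

theorem eval_outLengthExpr : (outLengthExpr k r).eval s = (ofState k r s).outLength := rfl

theorem eval_targetExpr (j : Expr) (t : ℕ) :
    (targetExpr k r j t).eval s = (ofState k r s).target (j.eval s) t := by
  simp only [targetExpr, codeExpr, eval, eval_mod]
  rfl

theorem eval_attachExpr (u g : Expr) :
    (attachExpr k r u g).eval s = (ofState k r s).attach (u.eval s) (g.eval s) := by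
  have h : ∀ t, (cond (eq (targetExpr k r (.div g (.lit (2 ^ k))) t) u) (.lit 1) (.lit 0)).eval s =
      if (ofState k r s).target (g.eval s / 2 ^ k) t = u.eval s then 1 else 0 := by
    intro t
    rw [eval_cond s (eval_eq s _ _), eval_targetExpr]
    rfl
  rw [attachExpr, eval_cond s (eval_lt s _ _)]
  simp only [eval_mod, eval_sum, eval, h]
  rfl

open Classical in
theorem eval_arcExpr (u v : Expr) : (arcExpr k r u v).eval s =
    if (ofState k r s).Arc (u.eval s) (v.eval s) then 1 else 0 := by
  rw [arcExpr, eval_cond s (eval_lt s _ _), eval_cond s (eval_lt s _ _), eval_wiresExpr k]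
  unfold Arc
  by_cases hu : u.eval s < (ofState k r s).wires
  · simp only [hu, if_true]
    by_cases hv : v.eval s < (ofState k r s).wires
    · simp only [hv, if_true, eval_eq]
      rfl
    · simp only [hv, if_false, eval, eval_lt, eval_eq, eval_attachExpr, eval_wiresExpr k,
        eval_gatesExpr k r]
      by_cases h₁ : v.eval s < (ofState k r s).wires + (ofState k r s).gates <;>
        by_cases h₂ : (ofState k r s).attach (u.eval s) (v.eval s - (ofState k r s).wires) = 1 <;>
        simp [h₁, h₂]
  · simp only [hu, if_false, eval_eq]
    rfl

open Classical in
theorem eval_adjExpr (u v : Expr) : (adjExpr k r u v).eval s =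
    if (ofState k r s).Adj (u.eval s) (v.eval s) then 1 else 0 := by
  rw [adjExpr, eval_cond s (eval_arcExpr k r s u v), eval_arcExpr]
  unfold Adj
  split_ifs <;> simp_all [eval]

open Classical in
theorem eval_inBagExpr (τ v : Expr) : (inBagExpr k r τ v).eval s =
    if (ofState k r s).InBag (τ.eval s) (v.eval s) then 1 else 0 := by
  rw [inBagExpr, eval_cond s (eval_lt s _ _), eval_wiresExpr k]
  unfold InBag
  by_cases hv : v.eval s < (ofState k r s).wires
  · simp only [hv, if_true, eval, eval_lt, Nat.lt_succ_iff]
    change _ = if τ.eval s ≤ v.eval s ∧ v.eval s ≤ τ.eval s + s.reg 1 then 1 else 0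
    split_ifs <;> simp_all
  · simp only [hv, if_false, eval_eq, eval, eval_mod]
    rfl

theorem eval_cellExpr : (cellExpr k r).eval s = (ofState k r s).cell (s.reg 4) := by
  classical
  simp only [cellExpr]
  rw [eval_cond s (eval_lt s _ _), eval_cond s (eval_eq s _ _), eval_cond s (eval_eq s _ _),
    eval_cond s (eval_lt s _ _), eval_adjExpr, eval_inBagExpr, eval_budgetExpr]
  simp only [eval, eval_mod, eval_orderExpr, eval_wiresExpr k]
  unfold cell
  congr

end Layout

/-! ### From formulas to instances -/

namespace KCNF

variable {k : ℕ} (φ : KCNF k)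

/-- The layout for a formula. -/
def layout (r : ℕ) : Layout :=
  ⟨φ.numVars, φ.clauses.length, k, r, fun a => φ.encode.getD (2 + a) 0⟩

theorem length_encode : φ.encode.length = 2 + k * φ.clauses.length := by
  rw [encode, List.length_append, length_flatMap_of_length_eq (w := k) (by simp), mul_comm]
  rfl

theorem getD_encode_literal {j t : ℕ} (hj : j < φ.clauses.length) (ht : t < k) :
    φ.encode.getD (2 + (k * j + t)) 0 =
      2 * ((φ.clauses[j] ⟨t, ht⟩).1 : ℕ) + ((φ.clauses[j] ⟨t, ht⟩).2).toNat := by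
  rw [encode, List.getD_append_right _ _ _ _ (by simp)]
  have h : 2 + (k * j + t) - [φ.numVars, φ.clauses.length].length = j * k + t := by
    simp [mul_comm]
  rw [h, getD_flatMap_of_length_eq (w := k) (by simp) _ _ hj ht,
    List.getD_eq_getElem _ _ (by simpa using ht), List.getElem_ofFn]

theorem getD_encode_le (a : ℕ) :
    φ.encode.getD a 0 ≤ 2 * φ.numVars + φ.clauses.length + 1 := by
  rcases Nat.lt_or_ge a φ.encode.length with h | h
  · rw [List.getD_eq_getElem _ _ h]
    have hmem := List.getElem_mem h
    generalize φ.encode[a] = z at hmem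
    simp only [encode, List.cons_append, List.nil_append, List.mem_cons, List.mem_flatMap,
      List.mem_ofFn] at hmem
    rcases hmem with rfl | rfl | ⟨C, -, t, rfl⟩
    · omega
    · omega
    · have h₁ := (C t).1.2
      have h₂ := Bool.toNat_le (C t).2
      omega
  · rw [List.getD_eq_default _ _ h]
    exact Nat.zero_le _

theorem valid_layout (hk : 3 ≤ k) {r : ℕ} (hr : r = 1 ∨ r = 2) : (φ.layout r).Valid where
  three_le := hk
  problem := hr
  code_lt j hj t ht := by
    change φ.encode.getD (2 + (k * j + t)) 0 / 2 < φ.numVars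
    rw [getD_encode_literal φ hj ht]
    have h₁ := (φ.clauses[j] ⟨t, ht⟩).1.2
    have h₂ := Bool.toNat_le (φ.clauses[j] ⟨t, ht⟩).2
    omega

theorem litVal_code (r : ℕ) (a : ℕ → ZMod 2) {j t : ℕ} (hj : j < φ.clauses.length) (ht : t < k) :
    Layout.litVal a ((φ.layout r).code (k * j + t)) = 1 ↔
      (decide (a (φ.clauses[j] ⟨t, ht⟩).1 = 1)) = (φ.clauses[j] ⟨t, ht⟩).2 := by
  have h : (φ.layout r).code (k * j + t) = _ := getD_encode_literal φ hj ht
  rw [h]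
  generalize φ.clauses[j] ⟨t, ht⟩ = q
  obtain ⟨i, b⟩ := q
  have two : ∀ z : ZMod 2, 1 + z = 1 ↔ ¬ z = 1 := by decide
  cases b
  · simp [Layout.litVal, two]
  · have : (2 * (i : ℕ) + 1) / 2 = i := by omega
    simp [Layout.litVal, this]

theorem sat_layout_iff (r : ℕ) : (φ.layout r).Sat ↔ φ.Satisfiable := by
  constructor
  · rintro ⟨a, ha⟩
    refine ⟨fun i => decide (a i = 1), fun C hC => ?_⟩
    obtain ⟨j, hj, rfl⟩ := List.getElem_of_mem hC
    obtain ⟨t, ht, h⟩ := ha j hj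
    exact ⟨⟨t, ht⟩, (litVal_code φ r a hj ht).1 h⟩
  · rintro ⟨π, hπ⟩
    refine ⟨fun i => if h : i < φ.numVars then if π ⟨i, h⟩ then 1 else 0 else 0, fun j hj => ?_⟩
    obtain ⟨⟨t, ht⟩, h⟩ := hπ _ (List.getElem_mem hj)
    refine ⟨t, ht, (litVal_code φ r _ hj ht).2 ?_⟩
    rw [← h]
    simp only [Fin.is_lt, dif_pos, Fin.eta]
    cases π (φ.clauses[j] ⟨t, ht⟩).1 <;> simp

/-- The instance for a formula. -/
noncomputable def toInstance (hk : 3 ≤ k) {r : ℕ} (hr : r = 1 ∨ r = 2) : LightsOutInstance :=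
  (φ.layout r).inst (φ.valid_layout hk hr)

/-- Some solution has size at most, equivalently exactly, the given number if and only if the
formula is satisfiable. -/
theorem hasSolution_toInstance_iff (hk : 3 ≤ k) {r : ℕ} (hr : r = 1 ∨ r = 2) :
    ((φ.toInstance hk hr).HasSolutionLE (φ.layout r).IsSolution ↔ φ.Satisfiable) ∧
      ((φ.toInstance hk hr).HasSolutionEQ (φ.layout r).IsSolution ↔ φ.Satisfiable) := by
  have hl := φ.valid_layout hk hr
  have h₁ : φ.Satisfiable → (φ.toInstance hk hr).HasSolutionEQ (φ.layout r).IsSolution :=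
    fun h => Layout.exists_solution_card_eq hl ((φ.sat_layout_iff r).2 h)
  have h₂ : (φ.toInstance hk hr).HasSolutionEQ (φ.layout r).IsSolution →
      (φ.toInstance hk hr).HasSolutionLE (φ.layout r).IsSolution :=
    fun ⟨S, hS, hc⟩ => ⟨S, hS, hc.le⟩
  have h₃ : (φ.toInstance hk hr).HasSolutionLE (φ.layout r).IsSolution → φ.Satisfiable :=
    fun ⟨S, hS, hc⟩ => (φ.sat_layout_iff r).1 (Layout.sat_of_solution hl hS hc)
  exact ⟨⟨h₃, fun h => h₂ (h₁ h)⟩, ⟨fun h => h₃ (h₂ h), h₁⟩⟩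

theorem order_layout_le {r : ℕ} (hr : r = 1 ∨ r = 2) :
    (φ.layout r).order ≤ (4 + 2 * 2 ^ k) * (φ.numVars + φ.clauses.length + 1) ^ 2 := by
  have hr2 : r ≤ 2 := by omega
  have key : ∀ n m : ℕ, n * ((r + 2) * m + r + 1) + r * ((m + 1) * 2 ^ k) ≤
      (4 + 2 * 2 ^ k) * (n + m + 1) ^ 2 := by
    intro n m
    have h₁ : (r + 2) * m + r + 1 ≤ 4 * (n + m + 1) := by
      have := Nat.mul_le_mul_right m (show r + 2 ≤ 4 by omega)
      omega
    have h₂ : n * ((r + 2) * m + r + 1) ≤ (n + m + 1) * (4 * (n + m + 1)) :=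
      Nat.mul_le_mul (by omega) h₁
    have h₃ : r * ((m + 1) * 2 ^ k) ≤ 2 * ((n + m + 1) ^ 2 * 2 ^ k) :=
      Nat.mul_le_mul hr2 (Nat.mul_le_mul_right _ (by nlinarith))
    calc _ ≤ (n + m + 1) * (4 * (n + m + 1)) + 2 * ((n + m + 1) ^ 2 * 2 ^ k) := add_le_add h₂ h₃
      _ = _ := by ring
  exact key _ _

end KCNF

open RAM in
/-- An algorithm for a problem on the instances that encodes satisfiability yields an algorithm for
`k`-SAT whose running time has the same base. -/
theorem DecidableInPathwidthTime.exists_sat_algorithm {k : ℕ} (hk : 3 ≤ k) {r : ℕ}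
    (hr : r = 1 ∨ r = 2) {b b' : ℝ} (hb : 0 ≤ b) (hbb' : b ≤ b') (hb' : 1 ≤ b')
    {L : LightsOutInstance → Prop} (hL : ∀ φ : KCNF k, L (φ.toInstance hk hr) ↔ φ.Satisfiable)
    (h : DecidableInPathwidthTime b L) :
    ∃ C c : ℕ, DecidableInTime (KCNF.encode (k := k)) KCNF.Satisfiable
      fun φ => C * b' ^ φ.numVars * ((φ.numVars + φ.clauses.length + 1 : ℕ) : ℝ) ^ c := by
  obtain ⟨C, c, h⟩ := h
  have hState : ∀ (φ : KCNF k) (s : State), s.reg 1 = φ.encode.getD 0 0 →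
      s.reg 2 = φ.encode.getD 1 0 →
      (∀ a, s.mem (s.reg 3 + (2 + a)) = φ.encode.getD (2 + a) 0) →
      Layout.ofState k r s = φ.layout r := by
    intro φ s h₁ h₂ h₃
    simp only [Layout.ofState, KCNF.layout, h₁, h₂, h₃]
    rfl
  have hlen : ∀ φ : KCNF k, (φ.toInstance hk hr).encode.length = (φ.layout r).outLength :=
    fun φ => Layout.length_encode_inst _
  have hentry : ∀ (φ : KCNF k) (a : ℕ), (φ.toInstance hk hr).encode.getD a 0 ≤
      (φ.layout r).outLength := by
    intro φ a
    rcases Nat.lt_or_ge a (φ.layout r).outLength with ha | ha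
    · have hl := φ.valid_layout hk hr
      rw [KCNF.toInstance, Layout.getD_encode_inst hl ha]
      have h₁ : 1 ≤ (φ.layout r).order := ((φ.layout r).inst hl).order_pos
      have h₂ := Layout.budget_le_order hl
      have h₃ := Nat.le_mul_self (φ.layout r).order
      have h₄ : (φ.layout r).wires + 1 ≤ ((φ.layout r).wires + 1) * (φ.layout r).order :=
        Nat.le_mul_of_pos_right _ h₁
      unfold Layout.cell Layout.outLength
      split_ifs <;> omega
    · rw [List.getD_eq_default _ _ (by rw [hlen]; exact ha)]
      exact Nat.zero_le _
  obtain ⟨d, hd⟩ := h.reduce (fun φ : KCNF k => φ.toInstance hk hr) hL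
    (.add (.lit 2) (.mul (.lit k) (.reg 2))) (Layout.outLengthExpr k r) (Layout.cellExpr k r)
    (fun φ => (φ.layout r).outLength + (2 * φ.numVars + φ.clauses.length + 1))
    (by
      intro φ s _ h₂
      rw [φ.length_encode]
      simp only [Expr.eval, h₂]
      rfl)
    (by
      intro φ s h₁ h₂
      rw [hlen]
      simp only [Layout.eval_outLengthExpr]
      -- The length depends on the registers only, not on the stored formula.
      have h := congrArg Layout.outLength (hState φ
        ⟨s.reg, fun a => φ.encode.getD (a - s.reg 3) 0⟩ h₁ h₂ fun a => by simp)
      exact h)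
    (by
      intro φ s h₁ h₂ h₃ h₄ h₅
      rw [Layout.eval_cellExpr, hState φ s h₁ h₂ (by intro a; rw [h₃, h₅])]
      rw [hlen] at h₄
      exact (Layout.getD_encode_inst _ h₄).symm)
    (by
      intro φ
      rw [hlen, φ.length_encode]
      have h₁ : (φ.clauses.length + 1) * 2 ^ k ≤ (φ.layout r).order :=
        Layout.gates_le_order (φ.valid_layout hk hr)
      have h₂ : k * φ.clauses.length ≤ (φ.clauses.length + 1) * 2 ^ k := by
        rw [mul_comm]
        exact Nat.mul_le_mul (by omega) Nat.lt_two_pow_self.le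
      have h₃ := Nat.le_mul_self (φ.layout r).order
      unfold Layout.outLength
      omega)
    (fun φ => by rw [hlen]; omega)
    (fun φ a => (φ.getD_encode_le a).trans (by omega))
    (fun φ a => (hentry φ a).trans (by omega))
  set A : ℕ := 4 + 2 * 2 ^ k with hA
  -- Constants that depend on `k` and on the given algorithm only.
  set K : ℝ := (8 + 3 * (A : ℝ) ^ 2) ^ d + C * b' ^ (2 * 2 ^ k) * (A : ℝ) ^ c with hK
  obtain ⟨C', hC'⟩ := exists_nat_ge K
  refine ⟨C', 4 * d + 2 * c, ?_⟩
  obtain ⟨p, hp⟩ := hd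
  refine ⟨p, fun φ => ?_⟩
  obtain ⟨t, s, hexec, ht, hs⟩ := hp φ
  refine ⟨t, s, hexec, ht.trans ?_, hs⟩
  have hl := φ.valid_layout hk hr
  set N : ℕ := φ.numVars + φ.clauses.length + 1 with hN
  have hN1 : 1 ≤ N := by omega
  have hN1' : (1 : ℝ) ≤ N := by exact_mod_cast hN1
  have horder : (φ.layout r).order ≤ A * N ^ 2 := φ.order_layout_le hr
  have hwires : (φ.layout r).wires + 1 ≤ (φ.layout r).order := (Layout.inst _ hl).length_le
  have hQ : (φ.layout r).outLength + (2 * φ.numVars + φ.clauses.length + 1) + 2 ≤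
      (8 + 3 * A ^ 2) * N ^ 4 := by
    have h₁ : (φ.layout r).order * (φ.layout r).order ≤ A ^ 2 * N ^ 4 := by
      calc _ ≤ A * N ^ 2 * (A * N ^ 2) := Nat.mul_le_mul horder horder
        _ = A ^ 2 * N ^ 4 := by ring
    have h₂ := Nat.mul_le_mul_right (φ.layout r).order hwires
    have h₃ : N ≤ N ^ 4 := Nat.le_self_pow (by norm_num) _
    have h₄ : (8 + 3 * A ^ 2) * N ^ 4 = 8 * N ^ 4 + 3 * (A ^ 2 * N ^ 4) := by ring
    rw [h₄, Layout.outLength]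
    omega
  have hfirst :
      (((φ.layout r).outLength + (2 * φ.numVars + φ.clauses.length + 1) : ℕ) + 2 : ℝ) ^ d ≤
      (8 + 3 * (A : ℝ) ^ 2) ^ d * (N : ℝ) ^ (4 * d) := by
    rw [pow_mul, ← mul_pow]
    exact pow_le_pow_left₀ (by positivity) (by exact_mod_cast hQ) d
  have hwidth : b ^ (φ.toInstance hk hr).decomp.width ≤ b' ^ φ.numVars * b' ^ (2 * 2 ^ k) := by
    rw [← pow_add]
    refine (pow_le_pow_left₀ hb hbb' _).trans (pow_le_pow_right₀ hb' ?_)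
    refine (Layout.width_decomp_le hl).trans (Nat.add_le_add_left (Nat.mul_le_mul_right _ ?_) _)
    change r ≤ 2
    omega
  have hsecond : (C : ℝ) * b ^ (φ.toInstance hk hr).decomp.width *
      ((φ.toInstance hk hr).order : ℝ) ^ c ≤
      C * (b' ^ φ.numVars * b' ^ (2 * 2 ^ k)) * ((A : ℝ) * (N : ℝ) ^ 2) ^ c := by
    refine mul_le_mul (mul_le_mul_of_nonneg_left hwidth (by positivity))
      (pow_le_pow_left₀ (by positivity) ?_ c) (by positivity) (by positivity)
    exact_mod_cast horder
  have hbn : 1 ≤ b' ^ φ.numVars := one_le_pow₀ hb'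
  calc _ ≤ (8 + 3 * (A : ℝ) ^ 2) ^ d * (N : ℝ) ^ (4 * d) +
        C * (b' ^ φ.numVars * b' ^ (2 * 2 ^ k)) * ((A : ℝ) * (N : ℝ) ^ 2) ^ c :=
        add_le_add hfirst hsecond
    _ ≤ (8 + 3 * (A : ℝ) ^ 2) ^ d * b' ^ φ.numVars * (N : ℝ) ^ (4 * d + 2 * c) +
        C * b' ^ (2 * 2 ^ k) * (A : ℝ) ^ c * b' ^ φ.numVars * (N : ℝ) ^ (4 * d + 2 * c) := by
        refine add_le_add ?_ ?_
        · refine mul_le_mul (le_mul_of_one_le_right (by positivity) hbn)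
            (pow_le_pow_right₀ hN1' (by omega)) (by positivity) (by positivity)
        · rw [mul_pow, ← pow_mul]
          have : (N : ℝ) ^ (2 * c) ≤ (N : ℝ) ^ (4 * d + 2 * c) :=
            pow_le_pow_right₀ hN1' (by omega)
          calc _ = C * b' ^ (2 * 2 ^ k) * (A : ℝ) ^ c * b' ^ φ.numVars * (N : ℝ) ^ (2 * c) := by
                ring
            _ ≤ _ := mul_le_mul_of_nonneg_left this (by positivity)
    _ = K * b' ^ φ.numVars * (N : ℝ) ^ (4 * d + 2 * c) := by rw [hK]; ring
    _ ≤ C' * b' ^ φ.numVars * (N : ℝ) ^ (4 * d + 2 * c) := by gcongr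

theorem RAM.Exec.cost_pos {p : RAM.Prog} {s s' : RAM.State} {t : ℕ} (h : RAM.Exec p s t s') :
    0 < t := by
  induction h <;> omega

/-- The graph without edges on two vertices, with a single bag of size two. -/
def pairInstance : LightsOutInstance where
  order := 2
  order_pos := by norm_num
  graph := ⊥
  decomp :=
    { length := 1
      bag := fun _ => Finset.univ
      vertex_mem := fun v => ⟨0, Finset.mem_univ v⟩
      edge_mem := fun u v _ => ⟨0, Finset.mem_univ u, Finset.mem_univ v⟩
      connected := fun v _ _ _ _ _ _ _ => Finset.mem_univ v }
  length_le := by norm_num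
  size := 0
  size_le := by norm_num

/-- For a base that is not positive, the time bound fails at width one already. -/
theorem not_decidableInPathwidthTime_of_nonpos {b : ℝ} (hb : b ≤ 0)
    (L : LightsOutInstance → Prop) : ¬ DecidableInPathwidthTime b L := by
  rintro ⟨C, c, p, hp⟩
  obtain ⟨t, s, hexec, ht, -⟩ := hp pairInstance
  have hw : pairInstance.decomp.width = 1 := by
    change (Finset.univ.sup fun _ : Fin 1 => (Finset.univ : Finset (Fin 2)).card) - 1 = 1
    simp
  simp only [hw, pow_one] at ht
  have h₁ : (0 : ℝ) < t := by exact_mod_cast hexec.cost_pos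
  have h₂ : (C : ℝ) * b * (pairInstance.order : ℝ) ^ c ≤ 0 :=
    mul_nonpos_of_nonpos_of_nonneg (mul_nonpos_of_nonneg_of_nonpos (by positivity) hb)
      (by positivity)
  linarith

/-- A problem that encodes satisfiability on the instances of formulas has no algorithm. -/
theorem SETH.not_decidableInPathwidthTime (hSETH : SETH) {ε : ℝ} (hε : 0 < ε) {r : ℕ}
    (hr : r = 1 ∨ r = 2) {L : LightsOutInstance → Prop}
    (hL : ∀ (k : ℕ) (hk : 3 ≤ k) (φ : KCNF k), L (φ.toInstance hk hr) ↔ φ.Satisfiable) :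
    ¬ DecidableInPathwidthTime (2 - ε) L := by
  intro h
  rcases le_or_gt (2 - ε) 0 with hneg | hpos
  · exact not_decidableInPathwidthTime_of_nonpos hneg L h
  obtain ⟨k, hk, hno⟩ := hSETH (min ε (1 / 2)) (by positivity)
    ((min_le_right _ _).trans_lt (by norm_num))
  refine hno (h.exists_sat_algorithm hk hr hpos.le ?_ ?_ (hL k hk))
  · linarith [min_le_left ε (1 / 2)]
  · linarith [min_le_right ε (1 / 2)]

theorem theorem3 (hSETH : SETH) (ε : ℝ) (hε : 0 < ε) :
    (¬ DecidableInPathwidthTime (2 - ε) fun I =>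
        I.HasSolutionLE (IsReflexiveAllOffSolution I.graph)) ∧
    (¬ DecidableInPathwidthTime (2 - ε) fun I =>
        I.HasSolutionLE (IsAllOffSolution I.graph)) ∧
    (¬ DecidableInPathwidthTime (2 - ε) fun I =>
        I.HasSolutionEQ (IsReflexiveAllOffSolution I.graph)) ∧
    (¬ DecidableInPathwidthTime (2 - ε) fun I =>
        I.HasSolutionEQ (IsAllOffSolution I.graph)) := by
  have h₁ : ∀ (k : ℕ) (φ : KCNF k), (φ.layout 1).IsSolution =
      IsReflexiveAllOffSolution (φ.layout 1).graph := fun k φ => by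
    funext S
    exact if_pos rfl
  have h₂ : ∀ (k : ℕ) (φ : KCNF k), (φ.layout 2).IsSolution =
      IsAllOffSolution (φ.layout 2).graph := fun k φ => by
    funext S
    exact if_neg (by change ¬ (2 : ℕ) = 1; norm_num)
  refine ⟨hSETH.not_decidableInPathwidthTime hε (r := 1) (.inl rfl) fun k hk φ => ?_,
    hSETH.not_decidableInPathwidthTime hε (r := 2) (.inr rfl) fun k hk φ => ?_,
    hSETH.not_decidableInPathwidthTime hε (r := 1) (.inl rfl) fun k hk φ => ?_,
    hSETH.not_decidableInPathwidthTime hε (r := 2) (.inr rfl) fun k hk φ => ?_⟩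
  · have := (φ.hasSolution_toInstance_iff hk (r := 1) (.inl rfl)).1
    rw [h₁] at this
    exact this
  · have := (φ.hasSolution_toInstance_iff hk (r := 2) (.inr rfl)).1
    rw [h₂] at this
    exact this
  · have := (φ.hasSolution_toInstance_iff hk (r := 1) (.inl rfl)).2
    rw [h₁] at this
    exact this
  · have := (φ.hasSolution_toInstance_iff hk (r := 2) (.inr rfl)).2
    rw [h₂] at this
    exact this
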